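/- **Network.** For $M\ge 0$ and $\varepsilon\in(0,1]$ consider the directed graph with the seven nodes $s_1,\ v,\ x,\ s_4,\ s_5,\ y,\ z$ and the seven edges $$e_1=(s_4,y),\quad e_2=(y,x),\quad e_3=(x,z),\quad e_4=(s_5,y),\quad e_5=(v,s_5),\quad e_6=(y,v),\quad e_7=(s_1,v),$$ with free flow travel times $\tau_{e_1}=\tau_{e_2}=\tau_{e_7}=1$, $\tau_{e_3}=\tau_{e_4}=\varepsilon$, $\tau_{e_5}=2-\varepsilon$, $\tau_{e_6}=4$ and service rates $\nu_{e_1}=\nu_{e_2}=\nu_{e_3}=1$, $\nu_{e_4}=\nu_{e_5}=2$, $\nu_{e_6}=\infty$, $\nu_{e_7}=6$. There are five commodities $i\in I=\{1,\dots,5\}$ with (source, destination) pairs $(s_1,v),\ (v,x),\ (x,z),\ (s_4,z),\ (s_5,y)$, network inflow rates $$r_1=6\cdot 1_{[0,1]},\quad r_2=2\cdot 1_{[2,3]},\quad r_3=1_{[7,10+M]},\quad r_4=1_{[4,5]},\quad r_5=2\cdot 1_{[9,13+M]},$$ and value-of-time parameters $\gamma_i=1$. Let $H'=[0,t_f']\subseteq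 H=[0,t_f]$ be horizons with $t_f'\ge 13+M$ and $t_f\ge t_f'+24+3M$. Let $L_+(H)$ be the set of nonnegative Lebesgue integrable functions on $H$, let $\mathcal W_i$ be the set of all finite walks (repetitions allowed) from the source to the destination of commodity $i$, and let $\mathcal W=\bigcup_i \mathcal W_i\times\{i\}$. **Travel times.** For an edge flow $g=(g_e)_e\in L_+(H)^E$ supported on $H'$, the traversal times $D_e(g,\cdot)$ are on $H'$ those of the Vickrey queuing model: with $T_e(g,t)=t+D_e(g,t)$ they are the unique solution of $$D_e(g,t)=\tau_e+\frac{q_e(g,t)}{\nu_e},\qquad q_e(g,t)=\int_0^t g_e\,d\sigma-\int_{T_e(g,\cdot)^{-1}([0,t+\tau_e])}g_e\,d\sigma ,$$ such that $q_e\ge 0$ and such that the outflow rate (the density of $t\mapsto\int_{T_e(g,\cdot)^{-1}([0,t])}g_e\,d\sigma$) exists and is at most $\nu_e$ almost everywhere. They are continued to $H$ in any nonnegative, absolutely continuous way for which $T_e(g,\cdot)$ is nondecreasing and all arrival times along walks stay in $H$. For a walk $w$ let $A_{w,1}(g,\cdot)=\mathrm{id}$ and $A_{w,j+1}(g,\cdot)=T_{w[j]}(g,\cdot)\circ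 A_{w,j}(g,\cdot)$. **Flows.** A walk flow $h=(h_w)_{w\in\mathcal W}\in L_+(H)^{\mathcal W}$ with $\sum_{w\in\mathcal W_i}h_w=r_i$ for all $i$ *induces* an edge flow $g\in L_+(H)^E$ supported on $H'$ if $$\int_0^t g_e\,d\sigma=\sum_{w\in\mathcal W}\ \sum_{j:\,w[j]=e}\ \int_{A_{w,j}(g,\cdot)^{-1}([0,t])}h_w\,d\sigma\qquad\text{for all edges } e \text{ and all } t\in H .$$ An edge flow is *system optimal* if it minimizes the total travel time $\sum_e\int_H D_e(g,t)\,g_e(t)\,dt$ among all edge flows induced by some walk flow. An edge flow $g$ is *implementable* (by anonymous dynamic tolls) if there are tolls $p:H\to\mathbb R_{\ge0}^E$ with $\sum_e\int_H p_e g_e\,d\sigma<\infty$ and a walk flow $h$ inducing $g$ such that for all $i$, all $w\in\mathcal W_i$ and almost all $t\in H$: if $h_w(t)>0$, then $w$ minimizes $$\gamma_i\sum_{j\le|w'|}D_{w'[j]}(g,A_{w',j}(g,t))+\sum_{j\le |w'|}p_{w'[j]}(A_{w',j}(g,t))$$ over all $w'\in\mathcal W_i$. **Theorem.** There is $M_0\ge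 0$ such that for all $M\ge M_0$ and all $\varepsilon\in(0,1]$ (and all horizons as above), no system optimal edge flow of this network is implementable. -/

import Mathlib

open Set MeasureTheory
open scoped ENNReal

/-- The data of a multi-source, multi-destination network with Vickrey queues: a finite directed
graph with nodes `V` and edges `E`, free flow travel times and (possibly infinite) service rates,
commodities `I` with sources, destinations, network inflow rates and values of time, the planning
horizon `H' = [0, tf']` and the larger technical horizon `H = [0, tf]`. -/
structure VickreyNetwork (V E I : Type) where
  tail : E → V
  head : E → V
  τ : E → ℝ
  ν : E → ℝ≥0∞
  source : I → V
  dest : I → V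
  inflow : I → ℝ → ℝ
  vot : I → ℝ
  tf' : ℝ
  tf : ℝ

namespace VickreyNetwork

variable {V E I : Type} (N : VickreyNetwork V E I)

/-- The full time horizon `H = [0, tf]`. -/
def H : Set ℝ := Icc 0 N.tf

/-- The planning horizon `H' = [0, tf']`. -/
def H' : Set ℝ := Icc 0 N.tf'

/-- `N.IsWalk v w v'`: the list of edges `w` is a walk from `v` to `v'`
(nodes and edges may be repeated). -/
def IsWalk : V → List E → V → Prop
  | v, [], v' => v = v'
  | v, e :: w, v' => N.tail e = v ∧ IsWalk (N.head e) w v'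

/-- The walks available to commodity `i`. -/
def Walk (i : I) : Type := {w : List E // N.IsWalk (N.source i) w (N.dest i)}

/-- All walk-commodity pairs. -/
def CWalk : Type := Σ i : I, N.Walk i

/-- `f` represents an element of `L₊(H)`. -/
def IsRate (f : ℝ → ℝ) : Prop :=
  IntegrableOn f N.H ∧ ∀ᵐ t ∂(volume.restrict N.H), 0 ≤ f t

/-- Given the traversal times `D`, the time at which a particle that enters the walk `w` at
time `t` reaches the end of `w`. -/
def exitTime (D : E → ℝ → ℝ) : List E → ℝ → ℝ
  | [], t => t
  | e :: w, t => exitTime D w (t + D e t)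

/-- The time at which a particle that enters `w` at time `t` has traversed the first `j` edges
of `w`, i.e. arrives at the tail of the edge with (zero-based) index `j`, or, for `j = |w|`, at
the end of `w`. -/
def arrival (D : E → ℝ → ℝ) (w : List E) (j : ℕ) : ℝ → ℝ :=
  exitTime D (w.take j)

/-- The sum of the edge costs `c` that a particle meets that enters `w` at time `t`, where the
cost of an edge is evaluated at the time of entering this edge. -/
def walkCost (D : E → ℝ → ℝ) (c : E → ℝ → ℝ) (w : List E) (t : ℝ) : ℝ :=
  ∑ j : Fin w.length, c (w.get j) (arrival D w j t)

/-- The volume of the inflow `f` into an edge with traversal time `d` that has left the edge up to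
time `t`, i.e. the integral of `f` over the preimage of `[0, t]` under the exit time function. -/
noncomputable def cumOutflow (f d : ℝ → ℝ) (t : ℝ) : ℝ :=
  ∫ s in {s ∈ N.H | s + d s ∈ Icc 0 t}, f s

/-- The volume of the queue at time `t` of an edge `e` with inflow `f` and traversal time `d`. -/
noncomputable def queue (e : E) (f d : ℝ → ℝ) (t : ℝ) : ℝ :=
  (∫ s in Icc 0 t, f s) - N.cumOutflow f d (t + N.τ e)

/-- `d` is the traversal time of the edge `e` in the Vickrey queuing model for the inflow rate `f`
(which counts as zero outside `H`): `d = τ + q / ν`, the queue `q` is nonnegative, and the outflow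
rate exists and is bounded by the service rate `ν`. For `ν = ∞`, the quotient `q / ν` is zero. -/
structure IsVickreyTime (e : E) (f d : ℝ → ℝ) : Prop where
  time_eq : ∀ t ∈ N.H, d t = N.τ e + N.queue e f d t * (N.ν e)⁻¹.toReal
  queue_nonneg : ∀ t ∈ N.H, 0 ≤ N.queue e f d t
  outflow : ∃ k : ℝ → ℝ, (∀ t, IntegrableOn k (Icc 0 t)) ∧
    (∀ᵐ t ∂(volume.restrict (Ici 0)), 0 ≤ k t ∧ ENNReal.ofReal (k t) ≤ N.ν e) ∧
    ∀ t, 0 ≤ t → N.cumOutflow f d t = ∫ s in Icc 0 t, k s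

/-- `D` is a family of edge traversal times on `H` for the edge flow `g`: on `H'` these are the
(unique) traversal times of the Vickrey model, and they are continued to `H` in an arbitrary
absolutely continuous, nonnegative, first-in first-out way, such that all arrival times at nodes
along walks of the commodities stay in `H`. -/
structure IsTraversalTime (g D : E → ℝ → ℝ) : Prop where
  vickrey : ∀ e, ∃ d : ℝ → ℝ, N.IsVickreyTime e (g e) d ∧ EqOn (D e) d N.H'
  nonneg : ∀ e, ∀ t ∈ N.H, 0 ≤ D e t
  absCont : ∀ e, AbsolutelyContinuousOnInterval (D e) 0 N.tf
  fifo : ∀ e, MonotoneOn (fun t => t + D e t) N.H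
  mapsTo : ∀ (i : I) (w : N.Walk i) (j : ℕ), j ≤ w.1.length → MapsTo (arrival D w.1 j) N.H N.H

open Classical in
/-- The walk flow `h` is admissible and induces the edge flow `g`, where `D` are the edge traversal
times under `g`. -/
structure Induces (h : N.CWalk → ℝ → ℝ) (g D : E → ℝ → ℝ) : Prop where
  isRate_walk : ∀ w, N.IsRate (h w)
  sum_walk : ∀ i, ∀ᵐ t ∂(volume.restrict N.H),
    HasSum (fun w : N.Walk i => h ⟨i, w⟩ t) (N.inflow i t)
  isRate_edge : ∀ e, N.IsRate (g e)
  support : ∀ e, ∀ᵐ t ∂(volume.restrict N.H), t ∉ N.H' → g e t = 0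
  traversal : N.IsTraversalTime g D
  loading : ∀ e, ∀ t ∈ N.H,
    HasSum
      (fun w : N.CWalk => ∑ j : Fin w.2.1.length,
        if w.2.1.get j = e then
          ∫ s in {s ∈ N.H | arrival D w.2.1 j s ∈ Icc 0 t}, h w s
        else 0)
      (∫ s in Icc 0 t, g e s)

/-- The pairing of edge costs `c` with an edge flow `g`. -/
noncomputable def pairing [Fintype E] (c g : E → ℝ → ℝ) : ℝ :=
  ∑ e, ∫ t in N.H, c e t * g e t

/-- `g` minimizes the total travel time among all induced edge flows. -/
def IsSystemOptimal [Fintype E] (g : E → ℝ → ℝ) : Prop :=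
  ∃ h D, N.Induces h g D ∧
    ∀ h' g' D', N.Induces h' g' D' → N.pairing D g ≤ N.pairing D' g'

/-- Wardrop's first principle for the walk flow `h` under traversal times `D` and tolls `p`: almost
all particles minimize the sum of their weighted travel time and their tolls. -/
def IsEquilibrium (h : N.CWalk → ℝ → ℝ) (D p : E → ℝ → ℝ) : Prop :=
  ∀ (i : I) (w : N.Walk i), ∀ᵐ t ∂(volume.restrict N.H), 0 < h ⟨i, w⟩ t →
    ∀ w' : N.Walk i,
      N.vot i * walkCost D D w.1 t + walkCost D p w.1 t ≤
        N.vot i * walkCost D D w'.1 t + walkCost D p w'.1 t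

/-- `g` is implementable by anonymous, nonnegative, finite, time-dependent edge tolls `p` with
finite total toll payments. -/
def IsImplementable (g : E → ℝ → ℝ) : Prop :=
  ∃ (h : N.CWalk → ℝ → ℝ) (D p : E → ℝ → ℝ), N.Induces h g D ∧
    (∀ e, ∀ t ∈ N.H, 0 ≤ p e t) ∧
    (∀ e, IntegrableOn (fun t => p e t * g e t) N.H) ∧
    N.IsEquilibrium h D p

end VickreyNetwork

/-- The seven nodes, named after the sources and destinations they carry. -/
inductive FigNode
  | s1 | s2d1 | s3d2 | s4 | s5 | d5 | d3d4

/-- The seven edges. -/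
inductive FigEdge
  | e1 | e2 | e3 | e4 | e5 | e6 | e7
  deriving DecidableEq

instance : Fintype FigEdge where
  elems := {.e1, .e2, .e3, .e4, .e5, .e6, .e7}
  complete := fun x => by cases x <;> simp

/-- The five commodities. -/
inductive FigComm
  | c1 | c2 | c3 | c4 | c5

open FigNode in
/-- The 5-commodity network with parameters `M` and `ε` and horizons `tf' < tf`. -/
noncomputable def figNetwork (M ε tf' tf : ℝ) : VickreyNetwork FigNode FigEdge FigComm where
  tail
    | .e1 => s4
    | .e2 => d5
    | .e3 => s3d2
    | .e4 => s5
    | .e5 => s2d1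
    | .e6 => d5
    | .e7 => s1
  head
    | .e1 => d5
    | .e2 => s3d2
    | .e3 => d3d4
    | .e4 => d5
    | .e5 => s5
    | .e6 => s2d1
    | .e7 => s2d1
  τ
    | .e1 => 1
    | .e2 => 1
    | .e3 => ε
    | .e4 => ε
    | .e5 => 2 - ε
    | .e6 => 4
    | .e7 => 1
  ν
    | .e1 => 1
    | .e2 => 1
    | .e3 => 1
    | .e4 => 2
    | .e5 => 2
    | .e6 => ⊤
    | .e7 => 6
  source
    | .c1 => s1
    | .c2 => s2d1
    | .c3 => s3d2
    | .c4 => s4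
    | .c5 => s5
  dest
    | .c1 => s2d1
    | .c2 => s3d2
    | .c3 => d3d4
    | .c4 => d3d4
    | .c5 => d5
  inflow
    | .c1 => (Icc 0 1).indicator fun _ => 6
    | .c2 => (Icc 2 3).indicator fun _ => 2
    | .c3 => (Icc 7 (10 + M)).indicator fun _ => 1
    | .c4 => (Icc 4 5).indicator fun _ => 1
    | .c5 => (Icc 9 (13 + M)).indicator fun _ => 2
  vot := fun _ => 1
  tf' := tf'
  tf := tf

/-! The argument plays a detour that helps everyone else against the fact that nonnegative tolls can
never make anyone take it. Commodity 1 is at its destination after `e7`; going on around the cycle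
`e5`, `e4`, `e6` costs it a positive amount of time and, as tolls are nonnegative, saves nothing. So
in every implementable flow commodity 1 stays off the cycle (`ae_eq_zero_of_isEquilibrium`).

Without commodity 1 on `e5`, commodity 2 travels freely and can reach `e2` in `[4, 5]` at rate 2,
twice the service rate. Commodity 4 arrives at `e2` from time 5 on, has to wait, and gets to `e3` in
part after time 7. There commodity 3 occupies the whole capacity during `[7, 10 + M]`, so a queue,
once there, stays for the whole interval. The only escape is that commodity 2 or 4 takes the detour
through the cycle. Then it enters `e4` after time 9 and before a time `K` independent of `M`, while
commodity 5 occupies the whole capacity of `e4` during `[9, 13 + M]`; again the queue persists. If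
`l` is the volume that takes the detour, the queues at `e4` and `e3` have volume at least `l` and `1
- l`, and together they cost at least `10 + M - K`, whatever `l` is (`IsDirect.le_pairing`).

If instead commodity 1 is sent once around the cycle, it builds up a queue on `e5` that delays
commodity 2 by 2 time units. Commodity 2 then reaches `e2` in `[6, 7]`, just after commodity 4 has
passed, and `e3` and `e4` never have a queue. Apart from the free flow costs on `e3` and `e4`, the
total travel time of this flow is bounded independently of `M` (`induces_optFlow`,
`pairing_optFlow_le`). For large `M` a direct flow is therefore not optimal.

The time `K` is `exitBound^[4] 5`, an extremely crude a priori bound for the time at which particles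
that start up to time 5 have traversed four edges. Only its independence of `M` and `ε` matters. All
lower bounds on queues use just the cumulative inflow into an edge (`IsTraversalTime.le_time`), so
uniqueness of traversal times is never needed. -/

namespace VickreyNetwork

/-! ### A single Vickrey edge: bounds on queues and exit times. -/

section Vickrey

variable {V E I : Type} {N : VickreyNetwork V E I} {e : E} {f d : ℝ → ℝ} {c : ℝ}

theorem IsRate.intervalMass_mono (hf : N.IsRate f) {s t : ℝ} (hst : s ≤ t) (ht : t ≤ N.tf) :
    ∫ u in Icc 0 s, f u ≤ ∫ u in Icc 0 t, f u := by
  have hsub : Icc 0 t ⊆ N.H := Icc_subset_Icc_right ht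
  exact setIntegral_mono_set (hf.1.mono_set hsub) (ae_restrict_of_ae_restrict_of_subset hsub hf.2)
    (Icc_subset_Icc_right hst).eventuallyLE

theorem setIntegral_Icc_sub {k : ℝ → ℝ} {s t : ℝ} (hk : IntegrableOn k (Icc 0 t)) (hs : 0 ≤ s)
    (hst : s ≤ t) : (∫ u in Icc 0 t, k u) - ∫ u in Icc 0 s, k u = ∫ u in Ioc s t, k u := by
  have h : Icc 0 t = Icc 0 s ∪ Ioc s t := (Icc_union_Ioc_eq_Icc hs hst).symm
  rw [h, setIntegral_union _ measurableSet_Ioc (hk.mono_set (Icc_subset_Icc_right hst))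
    (hk.mono_set (by rw [h]; exact subset_union_right))]
  · ring
  · rw [Set.disjoint_left]
    intro x hx hx'
    exact absurd hx.2 (not_le.2 hx'.1)

theorem IsVickreyTime.cumOutflow_mono (hd : N.IsVickreyTime e f d) {s t : ℝ} (hs : 0 ≤ s)
    (hst : s ≤ t) : N.cumOutflow f d s ≤ N.cumOutflow f d t := by
  obtain ⟨k, hk, hkν, hF⟩ := hd.outflow
  rw [hF s hs, hF t (hs.trans hst)]
  exact setIntegral_mono_set (hk t) ((ae_restrict_of_ae_restrict_of_subset
    (fun x hx => hx.1) hkν).mono fun x hx => hx.1) (Icc_subset_Icc_right hst).eventuallyLE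

theorem IsVickreyTime.cumOutflow_nonneg (hd : N.IsVickreyTime e f d) {t : ℝ} (ht : 0 ≤ t) :
    0 ≤ N.cumOutflow f d t := by
  obtain ⟨k, hk, hkν, hF⟩ := hd.outflow
  rw [hF t ht]
  exact integral_nonneg_of_ae ((ae_restrict_of_ae_restrict_of_subset
    (fun x hx => hx.1) hkν).mono fun x hx => hx.1)

theorem IsVickreyTime.cumOutflow_sub_le (hd : N.IsVickreyTime e f d)
    (hν : N.ν e = ENNReal.ofReal c) (hc : 0 ≤ c) {s t : ℝ} (hs : 0 ≤ s) (hst : s ≤ t) :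
    N.cumOutflow f d t - N.cumOutflow f d s ≤ c * (t - s) := by
  obtain ⟨k, hk, hkν, hF⟩ := hd.outflow
  rw [hF s hs, hF t (hs.trans hst), setIntegral_Icc_sub (hk t) hs hst]
  have hsub : Ioc s t ⊆ Ici 0 := fun x hx => hs.trans hx.1.le
  calc ∫ u in Ioc s t, k u ≤ ∫ u in Ioc s t, c := by
        refine setIntegral_mono_ae_restrict ((hk t).mono_set fun x hx => ⟨hsub hx, hx.2⟩) ?_ ?_
        · simp
        · refine (ae_restrict_of_ae_restrict_of_subset hsub hkν).mono fun x hx => ?_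
          have := hx.2
          rw [hν] at this
          exact (ENNReal.ofReal_le_ofReal_iff hc).1 this
    _ = c * (t - s) := by simp [hst, mul_comm]

/-- The queue at time `s` is nonnegative, and between the two times at most `c * (t - s)` can leave.
The bound involves the inflow alone and is the source of all lower bounds on waiting times. -/
theorem IsVickreyTime.le_queue (hd : N.IsVickreyTime e f d)
    (hν : N.ν e = ENNReal.ofReal c) (hc : 0 ≤ c) (hτ : 0 ≤ N.τ e) {s t : ℝ} (hs : 0 ≤ s)
    (hst : s ≤ t) (ht : t ≤ N.tf) :
    (∫ u in Icc 0 t, f u) - (∫ u in Icc 0 s, f u) - c * (t - s) ≤ N.queue e f d t := by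
  have h1 := hd.cumOutflow_sub_le hν hc (add_nonneg hs hτ) (by linarith : s + N.τ e ≤ t + N.τ e)
  have h2 := hd.queue_nonneg s ⟨hs, hst.trans ht⟩
  unfold queue at *
  linarith

theorem IsVickreyTime.queue_le (hd : N.IsVickreyTime e f d) (hτ : 0 ≤ N.τ e) {t : ℝ}
    (ht : 0 ≤ t) : N.queue e f d t ≤ ∫ u in Icc 0 t, f u := by
  have := hd.cumOutflow_nonneg (add_nonneg ht hτ)
  unfold queue
  linarith

theorem IsVickreyTime.time_eq_div (hd : N.IsVickreyTime e f d)
    (hν : N.ν e = ENNReal.ofReal c) (hc : 0 < c) {t : ℝ} (ht : t ∈ N.H) :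
    d t = N.τ e + N.queue e f d t / c := by
  rw [hd.time_eq t ht, hν, ENNReal.toReal_inv, ENNReal.toReal_ofReal hc.le, div_eq_mul_inv]

theorem IsVickreyTime.τ_le (hd : N.IsVickreyTime e f d) {t : ℝ} (ht : t ∈ N.H) :
    N.τ e ≤ d t := by
  rw [hd.time_eq t ht]
  exact le_add_of_nonneg_right (mul_nonneg (hd.queue_nonneg t ht) ENNReal.toReal_nonneg)

/-- The queue shrinks at rate at most `c`, so the waiting time decreases with slope at least `-1`.
-/
theorem IsVickreyTime.exit_mono (hd : N.IsVickreyTime e f d) (hf : N.IsRate f)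
    (hν : N.ν e = ENNReal.ofReal c) (hc : 0 < c) (hτ : 0 ≤ N.τ e) {s t : ℝ} (hs : 0 ≤ s)
    (hst : s ≤ t) (ht : t ≤ N.tf) : s + d s ≤ t + d t := by
  rw [hd.time_eq_div hν hc ⟨hs, hst.trans ht⟩, hd.time_eq_div hν hc ⟨hs.trans hst, ht⟩]
  have h1 := hd.cumOutflow_sub_le hν hc.le (add_nonneg hs hτ)
    (by linarith : s + N.τ e ≤ t + N.τ e)
  have h2 := hf.intervalMass_mono hst ht
  have h3 : N.queue e f d s - c * (t - s) ≤ N.queue e f d t := by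
    unfold queue
    linarith
  have h4 : (N.queue e f d s - c * (t - s)) / c ≤ N.queue e f d t / c := by gcongr
  rw [sub_div, mul_div_cancel_left₀ _ hc.ne'] at h4
  linarith

/-- Everything that entered up to time `t` has left the edge at the exit time of `t`. -/
theorem IsVickreyTime.le_cumOutflow_exit (hd : N.IsVickreyTime e f d) (hf : N.IsRate f)
    (hν : N.ν e = ENNReal.ofReal c) (hc : 0 < c) (hτ : 0 ≤ N.τ e) {t : ℝ}
    (ht : t ≤ N.tf) : ∫ u in Icc 0 t, f u ≤ N.cumOutflow f d (t + d t) := by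
  unfold cumOutflow
  have hsub : {s ∈ N.H | s + d s ∈ Icc 0 (t + d t)} ⊆ N.H := fun x hx => hx.1
  refine setIntegral_mono_set (hf.1.mono_set hsub) (ae_restrict_of_ae_restrict_of_subset hsub hf.2)
    (LE.le.eventuallyLE ?_)
  intro s hs
  refine ⟨⟨hs.1, hs.2.trans ht⟩, ?_, hd.exit_mono hf hν hc hτ hs.1 hs.2 ht⟩
  exact add_nonneg hs.1 (hτ.trans (hd.τ_le ⟨hs.1, hs.2.trans ht⟩))

theorem IsVickreyTime.continuousOn_queue (hd : N.IsVickreyTime e f d) (hf : N.IsRate f)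
    (hτ : 0 ≤ N.τ e) : ContinuousOn (N.queue e f d) N.H := by
  obtain ⟨k, hk, hkν, hF⟩ := hd.outflow
  refine ContinuousOn.sub ?_ ?_
  · have h := intervalIntegral.continuousOn_primitive_Icc (μ := volume) (f := f) (a := 0)
      (b := N.tf) hf.1
    exact h
  · have h := intervalIntegral.continuousOn_primitive_Icc (μ := volume) (f := k) (a := 0)
      (b := N.tf + N.τ e) (hk _)
    have h' : ContinuousOn (N.cumOutflow f d) (Icc 0 (N.tf + N.τ e)) :=
      h.congr fun t ht => hF t ht.1
    refine h'.comp (by fun_prop) fun t ht => ⟨add_nonneg ht.1 hτ, by simpa using ht.2⟩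

/-- No queue builds up as long as the inflow does not exceed the service rate. -/
theorem IsVickreyTime.queue_eq_zero (hd : N.IsVickreyTime e f d) (hf : N.IsRate f)
    (hν : N.ν e = ENNReal.ofReal c) (hc : 0 < c) (hτ : 0 ≤ N.τ e) {b : ℝ} (hb : b ≤ N.tf)
    (hG : ∀ s t, 0 ≤ s → s ≤ t → t ≤ b →
      (∫ u in Icc 0 t, f u) - (∫ u in Icc 0 s, f u) ≤ c * (t - s))
    {t : ℝ} (ht : t ∈ Icc 0 b) : N.queue e f d t = 0 := by
  refine le_antisymm ?_ (hd.queue_nonneg t ⟨ht.1, ht.2.trans hb⟩)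
  -- A strictly increasing positive barrier; `δ` tends to zero.
  suffices H : ∀ δ : ℝ, 0 < δ → N.queue e f d t ≤ δ * (1 + t) by
    by_contra! hcon
    have h1 : 0 < 1 + t := by linarith [ht.1]
    have := H (N.queue e f d t / (2 * (1 + t))) (by positivity)
    have h2 : N.queue e f d t / (2 * (1 + t)) * (1 + t) = N.queue e f d t / 2 := by
      field_simp
    linarith
  intro δ hδ
  have hq0 : N.queue e f d 0 ≤ 0 := by
    refine (hd.queue_le hτ le_rfl).trans ?_
    simp
  have hcont : ContinuousOn (N.queue e f d) (Icc 0 b) :=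
    (hd.continuousOn_queue hf hτ).mono (Icc_subset_Icc_right hb)
  -- A positive queue is served at full rate and cannot grow, so its slope is at most 0. For an
  -- empty queue the crude slope bound `c` suffices, because the queue is positive wherever it
  -- touches the barrier.
  refine image_le_of_liminf_slope_right_lt_deriv_boundary' (f := N.queue e f d)
    (f' := fun x => if 0 < N.queue e f d x then 0 else c) (a := 0) (b := b) hcont ?_
    (B := fun x => δ * (1 + x)) (B' := fun _ => δ) (by linarith) (by fun_prop) ?_ ?_ ht
  · intro x hx r hr
    refine Filter.Eventually.frequently ?_
    split_ifs at hr with hqx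
    · have hxz : Ioo x (min b (x + N.queue e f d x / c)) ∈ nhdsWithin x (Ioi x) :=
        Ioo_mem_nhdsGT (lt_min hx.2 (by linarith [div_pos hqx hc]))
      filter_upwards [hxz] with z hz
      have hzb : z ≤ b := (hz.2.trans_le (min_le_left _ _)).le
      have hzq : z ≤ x + N.queue e f d x / c := (hz.2.trans_le (min_le_right _ _)).le
      have hxH : x ∈ N.H := ⟨hx.1, hx.2.le.trans hb⟩
      -- All inflow up to `x` is out at the exit time of `x`. At most `c` per unit of time leaves
      -- between `z + τ` and that exit time, so the remainder must have left by `z + τ`.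
      have h1 := hd.le_cumOutflow_exit hf hν hc hτ hxH.2
      have h2 := hd.cumOutflow_sub_le hν hc.le (s := z + N.τ e) (t := x + d x)
        (by linarith [hz.1, hx.1]) (by rw [hd.time_eq_div hν hc hxH]; linarith)
      have h3 := hG x z hx.1 hz.1.le hzb
      have h4 : c * (x + d x - (z + N.τ e)) = N.queue e f d x - c * (z - x) := by
        rw [hd.time_eq_div hν hc hxH]
        field_simp
        ring
      have h5 : N.queue e f d z ≤ N.queue e f d x := by
        rw [h4] at h2
        have e1 : N.queue e f d z =
          (∫ u in Icc 0 z, f u) - N.cumOutflow f d (z + N.τ e) := rfl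
        linarith
      refine lt_of_le_of_lt ?_ hr
      rw [slope_def_field]
      exact div_nonpos_of_nonpos_of_nonneg (by linarith) (by linarith [hz.1])
    · filter_upwards [Ioo_mem_nhdsGT hx.2] with z hz
      refine lt_of_le_of_lt ?_ hr
      rw [slope_def_field, div_le_iff₀ (by linarith [hz.1])]
      have h1 := hd.cumOutflow_mono (s := x + N.τ e) (t := z + N.τ e) (by linarith [hx.1])
        (by linarith [hz.1])
      have h3 := hG x z hx.1 hz.1.le hz.2.le
      unfold queue
      linarith
  · intro x hx
    have : HasDerivAt (fun x : ℝ => δ * (1 + x)) (δ * 1) x :=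
      ((hasDerivAt_id x).const_add 1).const_mul δ
    simpa using this.hasDerivWithinAt
  · intro x hx hxB
    have : 0 < N.queue e f d x := by
      rw [hxB]
      exact mul_pos hδ (by linarith [hx.1])
    simp [this, hδ]

end Vickrey

end VickreyNetwork

namespace VickreyNetwork

/-! ### Arrival times along walks and the network loading. -/

section Loading

variable {V E I : Type} {N : VickreyNetwork V E I} {g D : E → ℝ → ℝ}
  {h : N.CWalk → ℝ → ℝ} {f : ℝ → ℝ}

theorem exitTime_append (D : E → ℝ → ℝ) (l₁ l₂ : List E) (t : ℝ) :
    exitTime D (l₁ ++ l₂) t = exitTime D l₂ (exitTime D l₁ t) := by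
  induction l₁ generalizing t with
  | nil => rfl
  | cons e l ih => exact ih _

theorem arrival_succ (D : E → ℝ → ℝ) (w : List E) {j : ℕ} (hj : j < w.length) (t : ℝ) :
    arrival D w (j + 1) t = arrival D w j t + D w[j] (arrival D w j t) := by
  unfold arrival
  rw [List.take_succ_eq_append_getElem hj, exitTime_append]
  rfl

theorem IsWalk.take {v v' : V} {l : List E} (hl : N.IsWalk v l v') (j : ℕ) :
    ∃ u, N.IsWalk v (l.take j) u := by
  induction l generalizing v j with
  | nil => exact ⟨v, by simp [IsWalk]⟩
  | cons e l ih =>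
    cases j with
    | zero => exact ⟨v, by simp [IsWalk]⟩
    | succ j =>
      obtain ⟨u, hu⟩ := ih hl.2 j
      exact ⟨u, hl.1, hu⟩

theorem IsTraversalTime.continuousOn (hD : N.IsTraversalTime g D) (e : E) :
    ContinuousOn (D e) N.H :=
  (hD.absCont e).continuousOn.mono Icc_subset_uIcc

theorem IsTraversalTime.continuousOn_arrival (hD : N.IsTraversalTime g D) {i : I} (w : N.Walk i)
    {j : ℕ} (hj : j ≤ w.1.length) : ContinuousOn (arrival D w.1 j) N.H := by
  induction j with
  | zero =>
    have : arrival D w.1 0 = id := by ext; simp [arrival, exitTime]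
    rw [this]
    exact continuousOn_id
  | succ j ih =>
    have ih' := ih (by omega)
    have : arrival D w.1 (j + 1) =
        fun t => arrival D w.1 j t + D (w.1[j]) (arrival D w.1 j t) := by
      ext t
      exact arrival_succ D w.1 (by omega) t
    rw [this]
    exact ih'.add ((hD.continuousOn _).comp ih' (hD.mapsTo i w j (by omega)))

theorem IsTraversalTime.arrival_le_arrival (hD : N.IsTraversalTime g D) {i : I} (w : N.Walk i)
    {j k : ℕ} (hjk : j ≤ k) (hk : k ≤ w.1.length) {s : ℝ} (hs : s ∈ N.H) :
    arrival D w.1 j s ≤ arrival D w.1 k s := by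
  induction k, hjk using Nat.le_induction with
  | base => exact le_rfl
  | succ k hjk ih =>
    refine (ih (by omega)).trans ?_
    rw [arrival_succ D w.1 (by omega)]
    exact le_add_of_nonneg_right (hD.nonneg _ _ (hD.mapsTo i w k (by omega) hs))

theorem IsTraversalTime.le_arrival (hD : N.IsTraversalTime g D) {i : I} (w : N.Walk i)
    {j : ℕ} (hj : j ≤ w.1.length) {s : ℝ} (hs : s ∈ N.H) : s ≤ arrival D w.1 j s :=
  hD.arrival_le_arrival w (Nat.zero_le j) hj hs

theorem IsTraversalTime.τ_le (hD : N.IsTraversalTime g D) (htf : N.tf' ≤ N.tf) (e : E) {t : ℝ}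
    (ht : t ∈ N.H') : N.τ e ≤ D e t := by
  obtain ⟨d, hd, hDd⟩ := hD.vickrey e
  rw [hDd ht]
  exact hd.τ_le ⟨ht.1, ht.2.trans htf⟩

/-- A lower bound on traversal times in terms of the inflow alone. -/
theorem IsTraversalTime.le_time (hD : N.IsTraversalTime g D) (htf : N.tf' ≤ N.tf) {e : E} {c : ℝ}
    (hν : N.ν e = ENNReal.ofReal c) (hc : 0 < c) (hτ : 0 ≤ N.τ e) {s t : ℝ} (hs : 0 ≤ s)
    (hst : s ≤ t) (ht : t ≤ N.tf') :
    N.τ e + ((∫ u in Icc 0 t, g e u) - (∫ u in Icc 0 s, g e u) - c * (t - s)) / c ≤ D e t := by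
  obtain ⟨d, hd, hDd⟩ := hD.vickrey e
  rw [hDd ⟨hs.trans hst, ht⟩, hd.time_eq_div hν hc ⟨hs.trans hst, ht.trans htf⟩]
  have := hd.le_queue hν hc.le hτ hs hst (ht.trans htf)
  gcongr

theorem IsTraversalTime.eq_τ (hD : N.IsTraversalTime g D) (htf : N.tf' ≤ N.tf) {e : E} {c : ℝ}
    (hg : N.IsRate (g e)) (hν : N.ν e = ENNReal.ofReal c) (hc : 0 < c) (hτ : 0 ≤ N.τ e) {b : ℝ}
    (hb : b ≤ N.tf') (hG : ∀ s t, 0 ≤ s → s ≤ t → t ≤ b →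
      (∫ u in Icc 0 t, g e u) - (∫ u in Icc 0 s, g e u) ≤ c * (t - s))
    {t : ℝ} (ht : t ∈ Icc 0 b) : D e t = N.τ e := by
  obtain ⟨d, hd, hDd⟩ := hD.vickrey e
  rw [hDd ⟨ht.1, ht.2.trans hb⟩, hd.time_eq_div hν hc ⟨ht.1, (ht.2.trans hb).trans htf⟩,
    hd.queue_eq_zero hg hν hc hτ (hb.trans htf) hG ht]
  simp

/-- A lower bound on the total travel time spent on an edge. -/
theorem IsTraversalTime.le_integral_mul (hD : N.IsTraversalTime g D) (htf : N.tf' ≤ N.tf) {e : E}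
    (hg : N.IsRate (g e)) (hsupp : ∀ᵐ t ∂(volume.restrict N.H), t ∉ N.H' → g e t = 0)
    {x y δ : ℝ} (hx : 0 ≤ x) (hxy : x ≤ y) (hy : y ≤ N.tf)
    (hδ : ∀ t ∈ Ioc x y, N.τ e + δ ≤ D e t) :
    N.τ e * (∫ t in N.H, g e t) + δ * ((∫ u in Icc 0 y, g e u) - ∫ u in Icc 0 x, g e u) ≤
      ∫ t in N.H, D e t * g e t := by
  have hsub : Ioc x y ⊆ N.H := fun t ht => ⟨hx.trans ht.1.le, ht.2.trans hy⟩
  have hint1 : IntegrableOn (fun t => N.τ e * g e t) N.H := hg.1.const_mul _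
  have hint2 : IntegrableOn ((Ioc x y).indicator fun t => δ * g e t) N.H :=
    (hg.1.const_mul δ).indicator measurableSet_Ioc
  have hint3 : IntegrableOn (fun t => D e t * g e t) N.H :=
    hg.1.continuousOn_mul (hD.continuousOn e) isCompact_Icc
  have h1 : N.τ e * (∫ t in N.H, g e t) +
      δ * ((∫ u in Icc 0 y, g e u) - ∫ u in Icc 0 x, g e u) =
      ∫ t in N.H, (N.τ e * g e t + (Ioc x y).indicator (fun t => δ * g e t) t) := by
    rw [integral_add hint1 hint2, setIntegral_indicator measurableSet_Ioc,
      inter_eq_self_of_subset_right hsub, integral_const_mul, integral_const_mul,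
      setIntegral_Icc_sub (hg.1.mono_set (Icc_subset_Icc_right hy)) hx hxy]
  rw [h1]
  refine setIntegral_mono_ae_restrict (hint1.add hint2) hint3 ?_
  filter_upwards [hg.2, hsupp, ae_restrict_mem measurableSet_Icc] with t ht0 hts htH
  -- Beyond the planning horizon nothing bounds `D e` from below by `τ`, but there the inflow
  -- vanishes.
  by_cases htH' : t ∈ N.H'
  · by_cases htxy : t ∈ Ioc x y
    · simp only [htxy, indicator_of_mem]
      nlinarith [hδ t htxy]
    · simp only [htxy, not_false_eq_true, indicator_of_notMem, add_zero]
      exact mul_le_mul_of_nonneg_right (hD.τ_le htf e htH') ht0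
  · simp [hts htH', indicator]

/-- The volume of a walk inflow `f` that has traversed the first `j` edges of `w` up to time
`t`. -/
noncomputable def arrivedMass (N : VickreyNetwork V E I) (D : E → ℝ → ℝ) (f : ℝ → ℝ) (w : List E)
    (j : ℕ) (t : ℝ) : ℝ :=
  ∫ s in {s ∈ N.H | arrival D w j s ∈ Icc 0 t}, f s

open Classical in
/-- The volume with which a walk inflow `f` into `w` has entered the edge `e` up to time `t`. -/
noncomputable def edgeMass (N : VickreyNetwork V E I) (D : E → ℝ → ℝ) (f : ℝ → ℝ) (w : List E)
    (e : E) (t : ℝ) : ℝ :=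
  ∑ j : Fin w.length, if w.get j = e then N.arrivedMass D f w j t else 0

theorem measurableSet_H : MeasurableSet N.H := measurableSet_Icc

theorem IsTraversalTime.measurableSet_arrived (hD : N.IsTraversalTime g D) {i : I} (w : N.Walk i)
    {j : ℕ} (hj : j ≤ w.1.length) (t : ℝ) :
    MeasurableSet {s ∈ N.H | arrival D w.1 j s ∈ Icc 0 t} :=
  ((hD.continuousOn_arrival w hj).preimage_isClosed_of_isClosed isClosed_Icc
    isClosed_Icc).measurableSet

theorem IsRate.arrivedMass_nonneg (hf : N.IsRate f) (w : List E) (j : ℕ) (t : ℝ) :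
    0 ≤ N.arrivedMass D f w j t :=
  integral_nonneg_of_ae (ae_restrict_of_ae_restrict_of_subset (fun _ hs => hs.1) hf.2)

theorem IsRate.arrivedMass_mono (hf : N.IsRate f) (w : List E) (j : ℕ) {t₁ t₂ : ℝ}
    (ht : t₁ ≤ t₂) : N.arrivedMass D f w j t₁ ≤ N.arrivedMass D f w j t₂ := by
  have hsub : {s ∈ N.H | arrival D w j s ∈ Icc 0 t₂} ⊆ N.H := fun _ hs => hs.1
  exact setIntegral_mono_set (hf.1.mono_set hsub)
    (ae_restrict_of_ae_restrict_of_subset hsub hf.2)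
    (LE.le.eventuallyLE fun s hs => ⟨hs.1, hs.2.1, hs.2.2.trans ht⟩)

theorem setIntegral_congr_of_ne_zero {A B S : Set ℝ} (hA : MeasurableSet A) (hB : MeasurableSet B)
    (hAS : A ⊆ S) (hBS : B ⊆ S)
    (hAB : ∀ᵐ s ∂(volume.restrict S), f s ≠ 0 → (s ∈ A ↔ s ∈ B)) :
    ∫ s in A, f s = ∫ s in B, f s := by
  have key : ∀ C, MeasurableSet C → C ⊆ S → ∫ s in C, f s = ∫ s in S, C.indicator f s := by
    intro C hC hCS
    rw [setIntegral_indicator hC, inter_eq_self_of_subset_right hCS]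
  rw [key A hA hAS, key B hB hBS]
  refine integral_congr_ae ?_
  filter_upwards [hAB] with s hs
  by_cases h0 : f s = 0
  · simp [indicator, h0]
  · by_cases hsB : s ∈ B
    · simp [hsB, (hs h0).2 hsB]
    · have : s ∉ A := fun hsA => hsB ((hs h0).1 hsA)
      simp [hsB, this]

/-- Arrival times are only understood for departures where the walk carries flow. Hence the preimage
may be replaced by any measurable set that agrees with it there. -/
theorem IsTraversalTime.arrivedMass_eq (hD : N.IsTraversalTime g D) {i : I} (w : N.Walk i)
    {j : ℕ} (hj : j ≤ w.1.length) {t : ℝ} {S : Set ℝ} (hS : MeasurableSet S) (hSH : S ⊆ N.H)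
    (hfS : ∀ᵐ s ∂(volume.restrict N.H), f s ≠ 0 → (arrival D w.1 j s ≤ t ↔ s ∈ S)) :
    N.arrivedMass D f w.1 j t = ∫ s in S, f s := by
  refine setIntegral_congr_of_ne_zero (hD.measurableSet_arrived w hj t) hS
    (fun _ hs => hs.1) hSH ?_
  filter_upwards [hfS, ae_restrict_mem measurableSet_H] with s hs hsH h0
  rw [← hs h0]
  exact ⟨fun h => h.2.2, fun h => ⟨hsH, (hD.mapsTo i w j hj hsH).1, h⟩⟩

theorem IsTraversalTime.arrivedMass_eq_mass (hD : N.IsTraversalTime g D) {i : I} (w : N.Walk i)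
    {j : ℕ} (hj : j ≤ w.1.length) {t : ℝ}
    (hft : ∀ᵐ s ∂(volume.restrict N.H), f s ≠ 0 → arrival D w.1 j s ≤ t) :
    N.arrivedMass D f w.1 j t = ∫ s in N.H, f s := by
  refine hD.arrivedMass_eq w hj measurableSet_H subset_rfl ?_
  filter_upwards [hft, ae_restrict_mem measurableSet_H] with s hs hsH h0
  exact iff_of_true (hs h0) hsH

theorem IsTraversalTime.arrivedMass_eq_zero (hD : N.IsTraversalTime g D) {i : I} (w : N.Walk i)
    {j : ℕ} (hj : j ≤ w.1.length) {t : ℝ}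
    (hft : ∀ᵐ s ∂(volume.restrict N.H), f s ≠ 0 → t < arrival D w.1 j s) :
    N.arrivedMass D f w.1 j t = 0 := by
  rw [hD.arrivedMass_eq w hj MeasurableSet.empty (empty_subset _) (t := t) (f := f)]
  · simp
  · filter_upwards [hft] with s hs h0
    simpa using hs h0

theorem IsTraversalTime.arrivedMass_tf (hD : N.IsTraversalTime g D) {i : I} (w : N.Walk i)
    {j : ℕ} (hj : j ≤ w.1.length) :
    N.arrivedMass D f w.1 j N.tf = ∫ s in N.H, f s := by
  refine hD.arrivedMass_eq_mass w hj ?_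
  filter_upwards [ae_restrict_mem measurableSet_H] with s hsH _
  exact (hD.mapsTo i w j hj hsH).2

theorem IsTraversalTime.arrivedMass_le (hD : N.IsTraversalTime g D) (hf : N.IsRate f) {i : I}
    (w : N.Walk i) {j : ℕ} (hj : j ≤ w.1.length) {t : ℝ} (ht : t ≤ N.tf) :
    N.arrivedMass D f w.1 j t ≤ ∫ s in Icc 0 t, f s := by
  have hsub : Icc 0 t ⊆ N.H := Icc_subset_Icc_right ht
  exact setIntegral_mono_set (hf.1.mono_set hsub)
    (ae_restrict_of_ae_restrict_of_subset hsub hf.2)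
    (LE.le.eventuallyLE fun s hs => ⟨hs.1.1, (hD.le_arrival w hj hs.1).trans hs.2.2⟩)

theorem arrivedMass_zero_eq (w : List E) {t : ℝ} (ht : t ≤ N.tf) :
    N.arrivedMass D f w 0 t = ∫ s in Icc 0 t, f s := by
  unfold arrivedMass
  congr 2
  ext s
  simp only [arrival, List.take_zero, exitTime, mem_ofPred_eq, H, mem_Icc]
  constructor
  · exact fun h => h.2
  · exact fun h => ⟨⟨h.1, h.2.trans ht⟩, h⟩

/-- A walk may visit `e` several times; every other visit contributes a nondecreasing term. -/
theorem IsRate.arrivedMass_sub_le_edgeMass_sub (hf : N.IsRate f) {w : List E} {j : ℕ}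
    (hj : j < w.length) {e : E} (he : w[j] = e) {t₁ t₂ : ℝ} (ht : t₁ ≤ t₂) :
    N.arrivedMass D f w j t₂ - N.arrivedMass D f w j t₁ ≤
      N.edgeMass D f w e t₂ - N.edgeMass D f w e t₁ := by
  classical
  unfold edgeMass
  rw [← Finset.sum_sub_distrib]
  have := Finset.single_le_sum (s := Finset.univ) (f := fun j : Fin w.length =>
    (if w.get j = e then N.arrivedMass D f w j t₂ else 0) -
      (if w.get j = e then N.arrivedMass D f w j t₁ else 0)) (fun k _ => ?_)
    (Finset.mem_univ (⟨j, hj⟩ : Fin w.length))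
  · simpa [he] using this
  · split_ifs
    · exact sub_nonneg.2 (hf.arrivedMass_mono w _ ht)
    · simp

theorem IsRate.edgeMass_mono (hf : N.IsRate f) {w : List E} {e : E} {t₁ t₂ : ℝ} (ht : t₁ ≤ t₂) :
    N.edgeMass D f w e t₁ ≤ N.edgeMass D f w e t₂ := by
  classical
  unfold edgeMass
  refine Finset.sum_le_sum fun k _ => ?_
  split_ifs
  · exact hf.arrivedMass_mono w _ ht
  · exact le_rfl

theorem IsRate.edgeMass_nonneg (hf : N.IsRate f) {w : List E} {e : E} {t : ℝ} :
    0 ≤ N.edgeMass D f w e t := by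
  classical
  unfold edgeMass
  refine Finset.sum_nonneg fun k _ => ?_
  split_ifs
  · exact hf.arrivedMass_nonneg w _ t
  · exact le_rfl

theorem IsRate.arrivedMass_le_edgeMass (hf : N.IsRate f) {w : List E} {j : ℕ}
    (hj : j < w.length) {e : E} (he : w[j] = e) (t : ℝ) :
    N.arrivedMass D f w j t ≤ N.edgeMass D f w e t := by
  classical
  unfold edgeMass
  have := Finset.single_le_sum (s := Finset.univ) (f := fun j : Fin w.length =>
    (if w.get j = e then N.arrivedMass D f w j t else 0)) (fun k _ => ?_)
    (Finset.mem_univ (⟨j, hj⟩ : Fin w.length))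
  · simpa [he] using this
  · split_ifs
    · exact hf.arrivedMass_nonneg w _ t
    · simp

theorem edgeMass_eq_arrivedMass {w : List E} {j : ℕ} (hj : j < w.length) {e : E} (he : w[j] = e)
    {t : ℝ} (h0 : ∀ k (hk : k < w.length), k ≠ j → w[k] = e → N.arrivedMass D f w k t = 0) :
    N.edgeMass D f w e t = N.arrivedMass D f w j t := by
  classical
  unfold edgeMass
  rw [Finset.sum_eq_single (⟨j, hj⟩ : Fin w.length)]
  · simp [he]
  · intro k _ hk
    split_ifs with hke
    · exact h0 k k.2 (fun h => hk (Fin.ext h)) hke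
    · rfl
  · simp

theorem edgeMass_eq_zero {w : List E} {e : E}
    {t : ℝ} (h0 : ∀ k (hk : k < w.length), w[k] = e → N.arrivedMass D f w k t = 0) :
    N.edgeMass D f w e t = 0 := by
  classical
  unfold edgeMass
  refine Finset.sum_eq_zero fun k _ => ?_
  split_ifs with hke
  · exact h0 k k.2 hke
  · rfl

/-- If only the first `n` edges of a walk can be reached up to time `t`, then each edge is entered
at most `n` times up to then. -/
theorem IsTraversalTime.edgeMass_le (hD : N.IsTraversalTime g D) (hf : N.IsRate f) {i : I}
    (w : N.Walk i) {e : E} {t : ℝ} (ht : t ≤ N.tf) {n : ℕ}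
    (hn : ∀ k, k ≤ w.1.length → n ≤ k → ∀ s ∈ N.H, t < arrival D w.1 k s) :
    N.edgeMass D f w.1 e t ≤ n * ∫ s in Icc 0 t, f s := by
  classical
  have hB : 0 ≤ ∫ s in Icc 0 t, f s := by
    rw [← arrivedMass_zero_eq (D := D) w.1 ht]
    exact hf.arrivedMass_nonneg _ _ _
  calc N.edgeMass D f w.1 e t
      ≤ ∑ j : Fin w.1.length, if (j : ℕ) < n then ∫ s in Icc 0 t, f s else 0 := by
        unfold edgeMass
        refine Finset.sum_le_sum fun j _ => ?_
        by_cases hjn : (j : ℕ) < n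
        · simp only [hjn, if_true]
          split_ifs
          · exact hD.arrivedMass_le hf w j.2.le ht
          · exact hB
        · have : N.arrivedMass D f w.1 j t = 0 := by
            refine hD.arrivedMass_eq_zero w j.2.le ?_
            filter_upwards [ae_restrict_mem measurableSet_H] with s hs _
            exact hn j j.2.le (not_lt.1 hjn) s hs
          simp [hjn, this]
    _ = ((Finset.univ.filter fun j : Fin w.1.length => (j : ℕ) < n).card : ℝ) *
          ∫ s in Icc 0 t, f s := by
        rw [← Finset.sum_filter, Finset.sum_const, nsmul_eq_mul]
    _ ≤ n * ∫ s in Icc 0 t, f s := by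
        refine mul_le_mul_of_nonneg_right ?_ hB
        have : (Finset.univ.filter fun j : Fin w.1.length => (j : ℕ) < n).card ≤
            (Finset.range n).card :=
          Finset.card_le_card_of_injOn (fun j => (j : ℕ)) (fun j hj => by simpa using hj)
            (fun a _ b _ hab => Fin.ext hab)
        rw [Finset.card_range] at this
        exact_mod_cast this

theorem hasSum_cwalk [Fintype I] {F : N.CWalk → ℝ} {S : I → ℝ}
    (hF : ∀ i, HasSum (fun w : N.Walk i => F ⟨i, w⟩) (S i)) : HasSum F (∑ i, S i) := by
  classical
  have h1 : ∀ i, HasSum (fun w : N.CWalk => if w.1 = i then F w else 0) (S i) := by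
    intro i
    have hinj : Function.Injective (fun w : N.Walk i => (⟨i, w⟩ : N.CWalk)) :=
      sigma_mk_injective
    refine (hinj.hasSum_iff ?_).1 ?_
    · rintro ⟨i', w⟩ hw
      have : i' ≠ i := by
        rintro rfl
        exact hw ⟨w, rfl⟩
      simp [this]
    · have hcomp : (fun w : N.CWalk => if w.1 = i then F w else 0) ∘
          (fun w : N.Walk i => (⟨i, w⟩ : N.CWalk)) = fun w => F ⟨i, w⟩ := by
        funext w
        exact if_pos rfl
      have hFi := hF i
      rw [← hcomp] at hFi
      exact hFi
  have h2 := hasSum_sum (s := Finset.univ) fun i _ => h1 i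
  simpa using h2

instance [Countable E] (i : I) : Countable (N.Walk i) :=
  inferInstanceAs (Countable {w : List E // N.IsWalk (N.source i) w (N.dest i)})

/-- The cycle gives infinitely many walks, so exchanging sum and integral needs dominated
convergence: the walk flows are nonnegative and their sum is the integrable network inflow. -/
theorem Induces.hasSum_setIntegral [Countable E] (hI : N.Induces h g D) (i : I)
    (hint : IntegrableOn (N.inflow i) N.H) {S : Set ℝ} (hS : S ⊆ N.H) :
    HasSum (fun w : N.Walk i => ∫ s in S, h ⟨i, w⟩ s) (∫ s in S, N.inflow i s) := by
  have hsum := ae_restrict_of_ae_restrict_of_subset hS (hI.sum_walk i)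
  refine hasSum_integral_of_dominated_convergence (fun w s => h ⟨i, w⟩ s)
    (fun w => ((hI.isRate_walk _).1.mono_set hS).aestronglyMeasurable) (fun w => ?_) ?_ ?_ hsum
  · filter_upwards [ae_restrict_of_ae_restrict_of_subset hS (hI.isRate_walk ⟨i, w⟩).2] with s hs
    rw [Real.norm_of_nonneg hs]
  · filter_upwards [hsum] with s hs using hs.summable
  · refine (hint.mono_set hS).congr ?_
    filter_upwards [hsum] with s hs using hs.tsum_eq.symm

theorem hasSum_ite_ne {α : Type*} [DecidableEq α] {F : α → ℝ} {S : ℝ} (hF : HasSum F S) (a : α) :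
    HasSum (fun x => if x = a then 0 else F x) (S - F a) := by
  refine (hF.sub (hasSum_ite_eq a (F a))).congr_fun ?_
  intro x
  split_ifs with hx
  · simp [hx]
  · simp

theorem Induces.ae_eq_zero [Countable E] (hI : N.Induces h g D) (i : I) {A : Set ℝ}
    (hA : ∀ᵐ s ∂(volume.restrict N.H), s ∉ A → N.inflow i s = 0) (w : N.Walk i) :
    ∀ᵐ s ∂(volume.restrict N.H), h ⟨i, w⟩ s ≠ 0 → s ∈ A := by
  have hnn : ∀ᵐ s ∂(volume.restrict N.H), ∀ w : N.Walk i, 0 ≤ h ⟨i, w⟩ s :=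
    ae_all_iff.2 fun w => (hI.isRate_walk ⟨i, w⟩).2
  filter_upwards [hA, hI.sum_walk i, hnn] with s hs hsum hnn h0
  by_contra hsA
  rw [hs hsA, hasSum_zero_iff_of_nonneg hnn] at hsum
  exact h0 (congrFun hsum w)

theorem Induces.hasSum_edgeMass (hI : N.Induces h g D) (e : E) {t : ℝ} (ht : t ∈ N.H) :
    HasSum (fun w : N.CWalk => N.edgeMass D (h w) w.2.1 e t) (∫ s in Icc 0 t, g e s) :=
  hI.loading e t ht

/-- This and the variants below reduce estimates of the cumulative inflow into an edge to walkwise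
estimates `m`, whose sum over all walks is known for each commodity. -/
theorem Induces.le_mass [Fintype I] (hI : N.Induces h g D) (e : E) {t : ℝ} (ht : t ∈ N.H)
    {m : ∀ i, N.Walk i → ℝ} {S : I → ℝ} (hm : ∀ i, HasSum (m i) (S i))
    (hle : ∀ i w, m i w ≤ N.edgeMass D (h ⟨i, w⟩) w.1 e t) :
    ∑ i, S i ≤ ∫ s in Icc 0 t, g e s := by
  have h1 : HasSum (fun w : N.CWalk => m w.1 w.2) (∑ i, S i) := hasSum_cwalk fun i => hm i
  have h2 := hI.hasSum_edgeMass e ht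
  refine hasSum_le ?_ h1 h2
  rintro ⟨i, w⟩
  exact hle i w

theorem Induces.mass_le [Fintype I] (hI : N.Induces h g D) (e : E) {t : ℝ} (ht : t ∈ N.H)
    {m : ∀ i, N.Walk i → ℝ} {S : I → ℝ} (hm : ∀ i, HasSum (m i) (S i))
    (hle : ∀ i w, N.edgeMass D (h ⟨i, w⟩) w.1 e t ≤ m i w) :
    ∫ s in Icc 0 t, g e s ≤ ∑ i, S i := by
  have h1 : HasSum (fun w : N.CWalk => m w.1 w.2) (∑ i, S i) := hasSum_cwalk fun i => hm i
  have h2 := hI.hasSum_edgeMass e ht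
  refine hasSum_le ?_ h2 h1
  rintro ⟨i, w⟩
  exact hle i w

theorem Induces.le_mass_sub [Fintype I] (hI : N.Induces h g D) (e : E) {t₁ t₂ : ℝ}
    (ht₁ : t₁ ∈ N.H) (ht₂ : t₂ ∈ N.H)
    {m : ∀ i, N.Walk i → ℝ} {S : I → ℝ} (hm : ∀ i, HasSum (m i) (S i))
    (hle : ∀ i w, m i w ≤
      N.edgeMass D (h ⟨i, w⟩) w.1 e t₂ - N.edgeMass D (h ⟨i, w⟩) w.1 e t₁) :
    ∑ i, S i ≤ (∫ s in Icc 0 t₂, g e s) - ∫ s in Icc 0 t₁, g e s := by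
  have h1 : HasSum (fun w : N.CWalk => m w.1 w.2) (∑ i, S i) := hasSum_cwalk fun i => hm i
  have h2 := (hI.hasSum_edgeMass e ht₂).sub (hI.hasSum_edgeMass e ht₁)
  refine hasSum_le ?_ h1 h2
  rintro ⟨i, w⟩
  exact hle i w

theorem Induces.mass_eq [Fintype I] (hI : N.Induces h g D) (e : E) {t : ℝ} (ht : t ∈ N.H)
    {m : ∀ i, N.Walk i → ℝ} {S : I → ℝ} (hm : ∀ i, HasSum (m i) (S i))
    (hle : ∀ i w, N.edgeMass D (h ⟨i, w⟩) w.1 e t = m i w) :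
    ∫ s in Icc 0 t, g e s = ∑ i, S i :=
  le_antisymm (hI.mass_le e ht hm fun i w => (hle i w).le)
    (hI.le_mass e ht hm fun i w => (hle i w).ge)

end Loading

end VickreyNetwork

/-! ### The concrete network: finite sums and the shape of its walks. -/

open VickreyNetwork FigNode FigEdge FigComm

instance : DecidableEq FigComm := fun a b => by
  cases a <;> cases b <;> first | exact isTrue rfl | exact isFalse nofun

instance : Fintype FigComm where
  elems := {.c1, .c2, .c3, .c4, .c5}
  complete := fun x => by cases x <;> simp

theorem FigComm.sum_univ (f : FigComm → ℝ) :
    ∑ i, f i = f c1 + f c2 + f c3 + f c4 + f c5 := by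
  have : (Finset.univ : Finset FigComm) = {.c1, .c2, .c3, .c4, .c5} := rfl
  rw [this]
  simp
  ring

theorem FigEdge.sum_univ (f : FigEdge → ℝ) :
    ∑ e, f e = f e1 + f e2 + f e3 + f e4 + f e5 + f e6 + f e7 := by
  have : (Finset.univ : Finset FigEdge) = {.e1, .e2, .e3, .e4, .e5, .e6, .e7} := rfl
  rw [this]
  simp
  ring

namespace FigNet

section Walks

variable {M ε tf' tf : ℝ} {w : List FigEdge} {v : FigNode}

theorem isWalk_s1 (hw : (figNetwork M ε tf' tf).IsWalk s1 w v) :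
    w = [] ∧ v = s1 ∨ ∃ w', w = e7 :: w' ∧ (figNetwork M ε tf' tf).IsWalk s2d1 w' v := by
  rcases w with _ | ⟨e, w⟩
  · exact Or.inl ⟨rfl, hw.symm⟩
  · cases e <;> first | exact Or.inr ⟨w, rfl, hw.2⟩ | exact absurd hw.1 nofun

theorem isWalk_s2d1 (hw : (figNetwork M ε tf' tf).IsWalk s2d1 w v) :
    w = [] ∧ v = s2d1 ∨ ∃ w', w = e5 :: w' ∧ (figNetwork M ε tf' tf).IsWalk s5 w' v := by
  rcases w with _ | ⟨e, w⟩
  · exact Or.inl ⟨rfl, hw.symm⟩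
  · cases e <;> first | exact Or.inr ⟨w, rfl, hw.2⟩ | exact absurd hw.1 nofun

theorem isWalk_s5 (hw : (figNetwork M ε tf' tf).IsWalk s5 w v) :
    w = [] ∧ v = s5 ∨ ∃ w', w = e4 :: w' ∧ (figNetwork M ε tf' tf).IsWalk d5 w' v := by
  rcases w with _ | ⟨e, w⟩
  · exact Or.inl ⟨rfl, hw.symm⟩
  · cases e <;> first | exact Or.inr ⟨w, rfl, hw.2⟩ | exact absurd hw.1 nofun

theorem isWalk_s4 (hw : (figNetwork M ε tf' tf).IsWalk s4 w v) :
    w = [] ∧ v = s4 ∨ ∃ w', w = e1 :: w' ∧ (figNetwork M ε tf' tf).IsWalk d5 w' v := by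
  rcases w with _ | ⟨e, w⟩
  · exact Or.inl ⟨rfl, hw.symm⟩
  · cases e <;> first | exact Or.inr ⟨w, rfl, hw.2⟩ | exact absurd hw.1 nofun

theorem isWalk_d5 (hw : (figNetwork M ε tf' tf).IsWalk d5 w v) :
    w = [] ∧ v = d5 ∨ (∃ w', w = e2 :: w' ∧ (figNetwork M ε tf' tf).IsWalk s3d2 w' v) ∨
      ∃ w', w = e6 :: w' ∧ (figNetwork M ε tf' tf).IsWalk s2d1 w' v := by
  rcases w with _ | ⟨e, w⟩
  · exact Or.inl ⟨rfl, hw.symm⟩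
  · cases e <;> first
      | exact Or.inr (Or.inl ⟨w, rfl, hw.2⟩)
      | exact Or.inr (Or.inr ⟨w, rfl, hw.2⟩)
      | exact absurd hw.1 nofun

theorem isWalk_s3d2 (hw : (figNetwork M ε tf' tf).IsWalk s3d2 w v) :
    w = [] ∧ v = s3d2 ∨ w = [e3] ∧ v = d3d4 := by
  rcases w with _ | ⟨e, w⟩
  · exact Or.inl ⟨rfl, hw.symm⟩
  · rcases w with _ | ⟨e', w⟩
    · cases e <;> first | exact Or.inr ⟨rfl, hw.2.symm⟩ | exact absurd hw.1 nofun
    · obtain ⟨h₁, h₂, _⟩ := hw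
      cases e <;> cases e' <;> simp_all [figNetwork]

theorem walk_c1 (hw : (figNetwork M ε tf' tf).IsWalk s1 w s2d1) :
    w = [e7] ∨ ∃ w', w = e7 :: e5 :: w' := by
  obtain ⟨_, h⟩ | ⟨w, rfl, hw₁⟩ := isWalk_s1 hw
  · cases h
  obtain ⟨rfl, _⟩ | ⟨w, rfl, _⟩ := isWalk_s2d1 hw₁
  · exact Or.inl rfl
  · exact Or.inr ⟨w, rfl⟩

/-- The only choice is at `d5`: taking `e2` ends the walk, while `e6` leads back and forces another
passage of `e5` and `e4`. -/
theorem walk_c2 (hw : (figNetwork M ε tf' tf).IsWalk s2d1 w s3d2) :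
    w = [e5, e4, e2] ∨ ∃ w', w = e5 :: e4 :: e6 :: e5 :: e4 :: w' := by
  obtain ⟨_, h⟩ | ⟨w, rfl, hw₁⟩ := isWalk_s2d1 hw
  · cases h
  obtain ⟨_, h⟩ | ⟨w, rfl, hw₂⟩ := isWalk_s5 hw₁
  · cases h
  obtain ⟨_, h⟩ | ⟨w, rfl, hw₃⟩ | ⟨w, rfl, hw₃⟩ := isWalk_d5 hw₂
  · cases h
  · obtain ⟨rfl, _⟩ | ⟨_, h⟩ := isWalk_s3d2 hw₃
    · exact Or.inl rfl
    · cases h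
  obtain ⟨_, h⟩ | ⟨w, rfl, hw₄⟩ := isWalk_s2d1 hw₃
  · cases h
  obtain ⟨_, h⟩ | ⟨w, rfl, hw₅⟩ := isWalk_s5 hw₄
  · cases h
  exact Or.inr ⟨w, rfl⟩

theorem walk_c3 (hw : (figNetwork M ε tf' tf).IsWalk s3d2 w d3d4) : w = [e3] := by
  obtain ⟨_, h⟩ | ⟨rfl, _⟩ := isWalk_s3d2 hw
  · cases h
  · rfl

theorem walk_c4 (hw : (figNetwork M ε tf' tf).IsWalk s4 w d3d4) :
    w = [e1, e2, e3] ∨ ∃ w', w = e1 :: e6 :: e5 :: e4 :: w' := by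
  obtain ⟨_, h⟩ | ⟨w, rfl, hw₁⟩ := isWalk_s4 hw
  · cases h
  obtain ⟨_, h⟩ | ⟨w, rfl, hw₂⟩ | ⟨w, rfl, hw₂⟩ := isWalk_d5 hw₁
  · cases h
  · rw [walk_c3 hw₂]
    exact Or.inl rfl
  obtain ⟨_, h⟩ | ⟨w, rfl, hw₃⟩ := isWalk_s2d1 hw₂
  · cases h
  obtain ⟨_, h⟩ | ⟨w, rfl, hw₄⟩ := isWalk_s5 hw₃
  · cases h
  exact Or.inr ⟨w, rfl⟩

theorem walk_c5 (hw : (figNetwork M ε tf' tf).IsWalk s5 w d5) : ∃ w', w = e4 :: w' := by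
  obtain ⟨_, h⟩ | ⟨w, rfl, _⟩ := isWalk_s5 hw
  · cases h
  · exact ⟨w, rfl⟩

end Walks

/-! ### A priori bounds on arrival times, uniform in `M` and `ε`. -/

section Crude

variable {M ε tf' tf : ℝ} {g D : FigEdge → ℝ → ℝ}
  {h : (figNetwork M ε tf' tf).CWalk → ℝ → ℝ}

/-- A node potential showing that free flow travel times are at least `1 / 2` per edge up to a
bounded error. -/
noncomputable def potential : FigNode → ℝ
  | .s5 => 1 / 2
  | .s3d2 => 1 / 2
  | _ => 0

theorem potential_nonneg (v : FigNode) : 0 ≤ potential v := by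
  cases v <;> norm_num [potential]

theorem potential_le (v : FigNode) : potential v ≤ 1 / 2 := by
  cases v <;> norm_num [potential]

/-- The edges `e3` and `e4` may be arbitrarily short. The potential credits them with surplus time
from their predecessors `e2` and `e5`. -/
theorem potential_head_le (hε : 0 < ε) (hε1 : ε ≤ 1) (e : FigEdge) :
    1 / 2 + potential ((figNetwork M ε tf' tf).head e) ≤
      (figNetwork M ε tf' tf).τ e + potential ((figNetwork M ε tf' tf).tail e) := by
  cases e <;> simp only [figNetwork, potential] <;> linarith

theorem τ_nonneg (hε : 0 < ε) (hε1 : ε ≤ 1) (e : FigEdge) :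
    0 ≤ (figNetwork M ε tf' tf).τ e := by
  cases e <;> simp only [figNetwork] <;> linarith

theorem τ_le_four (hε : 0 < ε) (hε1 : ε ≤ 1) (e : FigEdge) :
    (figNetwork M ε tf' tf).τ e ≤ 4 := by
  cases e <;> simp only [figNetwork] <;> linarith

theorem inv_ν_le_one (e : FigEdge) : ((figNetwork M ε tf' tf).ν e)⁻¹.toReal ≤ 1 := by
  cases e <;> simp only [figNetwork] <;> norm_num

/-- The potential telescopes along the walk. Free flow times bound `D` only on `H'`, hence the
condition on the exit time; the first conjunct passes this condition on to all earlier arrival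
times. -/
theorem length_le_exitTime (hε : 0 < ε) (hε1 : ε ≤ 1) (htf : tf' ≤ tf)
    (hD : (figNetwork M ε tf' tf).IsTraversalTime g D) {v v' : FigNode} {l : List FigEdge}
    (hl : (figNetwork M ε tf' tf).IsWalk v l v') {s : ℝ}
    (hs : ∀ j, j ≤ l.length → arrival D l j s ∈ Icc 0 tf) :
    s ≤ exitTime D l s ∧ (exitTime D l s ≤ tf' →
      s + l.length / 2 + potential v' ≤ exitTime D l s + potential v) := by
  induction l generalizing v s with
  | nil =>
    cases hl
    simp [exitTime]
  | cons e l ih =>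
    have hs0 : s ∈ Icc 0 tf := hs 0 (Nat.zero_le _)
    obtain ⟨h1, h2⟩ := ih hl.2 (s := s + D e s) fun j hj => hs (j + 1) (by simpa using hj)
    have h3 : 0 ≤ D e s := hD.nonneg e s hs0
    refine ⟨by change s ≤ exitTime D l (s + D e s); linarith, fun hle => ?_⟩
    have hle' : exitTime D l (s + D e s) ≤ tf' := hle
    have h4 := h2 hle'
    have h5 : (figNetwork M ε tf' tf).τ e ≤ D e s :=
      hD.τ_le htf e ⟨hs0.1, by change s ≤ tf'; linarith⟩
    have h6 := potential_head_le (M := M) (tf' := tf') (tf := tf) hε hε1 e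
    rw [hl.1] at h6
    change s + ((l.length + 1 : ℕ) : ℝ) / 2 + potential v' ≤
      exitTime D l (s + D e s) + potential v
    push_cast
    linarith

/-- By the potential bound, `2 * n + 2` edges take at least `n + 1 - 1 / 2` time units, which
exceeds `n`. -/
theorem lt_arrival_of_le (hε : 0 < ε) (hε1 : ε ≤ 1) (htf : tf' ≤ tf)
    (hD : (figNetwork M ε tf' tf).IsTraversalTime g D) {i : FigComm}
    (w : (figNetwork M ε tf' tf).Walk i) {n : ℕ} (hn : (n : ℝ) ≤ tf') {k : ℕ}
    (hk : k ≤ w.1.length) (hnk : 2 * n + 2 ≤ k) {s : ℝ} (hs : s ∈ Icc 0 tf) :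
    n < arrival D w.1 k s := by
  by_contra! hcon
  obtain ⟨u, hu⟩ := w.2.take k
  have := (length_le_exitTime hε hε1 htf hD hu (s := s) fun j hj => by
    have hjk : j ≤ k := hj.trans (List.length_take_le _ _)
    have := hD.mapsTo i w j (hjk.trans hk) hs
    unfold arrival at this ⊢
    rwa [List.take_take, min_eq_left hjk]).2 (hcon.trans hn)
  rw [List.length_take, min_eq_left hk] at this
  have h1 := potential_nonneg u
  have h2 := potential_le ((figNetwork M ε tf' tf).source i)
  have h3 : ((2 * n + 2 : ℕ) : ℝ) ≤ k := by exact_mod_cast hnk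
  push_cast at h3
  have h4 : exitTime D (w.1.take k) s ≤ n := hcon
  linarith [hs.1]

theorem inflow_mem (i : FigComm) (s : ℝ) :
    (figNetwork M ε tf' tf).inflow i s ∈ Icc (0 : ℝ) 6 := by
  cases i <;> simp only [figNetwork, indicator] <;> split_ifs <;> norm_num

theorem integrableOn_inflow (i : FigComm) {S : Set ℝ} (hS : volume S < ⊤) :
    IntegrableOn ((figNetwork M ε tf' tf).inflow i) S := by
  cases i <;> exact (integrableOn_const hS.ne).indicator measurableSet_Icc

/-- Up to time `n` at most `30 * n` enters the network (five commodities with rate at most 6), and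
each particle enters the edge at most `2 * n + 2` times. -/
theorem mass_le_of_le (hε : 0 < ε) (hε1 : ε ≤ 1) (htf : tf' ≤ tf)
    (hI : (figNetwork M ε tf' tf).Induces h g D) (e : FigEdge) {n : ℕ} (hn : (n : ℝ) ≤ tf')
    {t : ℝ} (ht : t ≤ n) : ∫ s in Icc 0 t, g e s ≤ (2 * n + 2) * (30 * n) := by
  have hnH : (n : ℝ) ∈ (figNetwork M ε tf' tf).H := ⟨by positivity, hn.trans htf⟩
  have hsub : Icc (0 : ℝ) n ⊆ (figNetwork M ε tf' tf).H := Icc_subset_Icc_right hnH.2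
  refine ((hI.isRate_edge e).intervalMass_mono ht hnH.2).trans ?_
  have key := hI.mass_le e hnH
    (m := fun i w => ((2 * n + 2 : ℕ) : ℝ) * ∫ s in Icc 0 (n : ℝ), h ⟨i, w⟩ s)
    (S := fun i => ((2 * n + 2 : ℕ) : ℝ) *
      ∫ s in Icc 0 (n : ℝ), (figNetwork M ε tf' tf).inflow i s)
    (fun i => (hI.hasSum_setIntegral i (integrableOn_inflow i (by simp [VickreyNetwork.H]))
      hsub).mul_left _)
    (fun i w => hI.traversal.edgeMass_le (hI.isRate_walk _) w hnH.2 fun k hk hnk s hs =>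
      lt_arrival_of_le hε hε1 htf hI.traversal w hn hk hnk hs)
  refine key.trans ?_
  rw [← Finset.mul_sum]
  push_cast
  gcongr
  calc ∑ i, ∫ s in Icc 0 (n : ℝ), (figNetwork M ε tf' tf).inflow i s
      ≤ ∑ i : FigComm, 6 * (n : ℝ) := by
        refine Finset.sum_le_sum fun i _ => ?_
        calc ∫ s in Icc 0 (n : ℝ), (figNetwork M ε tf' tf).inflow i s
            ≤ ∫ s in Icc 0 (n : ℝ), (6 : ℝ) :=
              setIntegral_mono (integrableOn_inflow i (by simp)) (by simp)
                fun s => (inflow_mem i s).2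
          _ = 6 * n := by simp [mul_comm]
    _ = 30 * n := by
        rw [FigComm.sum_univ]
        ring

/-- A crude bound on the exit time of an edge entered up to time `n`. -/
def exitBound (n : ℕ) : ℕ := n + 4 + (2 * n + 2) * (30 * n)

theorem le_exitBound (n : ℕ) : n ≤ exitBound n := by
  unfold exitBound
  omega

/-- The queue is at most the inflow so far, service rates are at least 1, and free flow times are at
most 4. -/
theorem exit_le_exitBound (hε : 0 < ε) (hε1 : ε ≤ 1) (htf : tf' ≤ tf)
    (hI : (figNetwork M ε tf' tf).Induces h g D) (e : FigEdge) {n : ℕ} (hn : (n : ℝ) ≤ tf')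
    {t : ℝ} (ht0 : 0 ≤ t) (ht : t ≤ n) : t + D e t ≤ exitBound n := by
  obtain ⟨d, hd, hDd⟩ := hI.traversal.vickrey e
  have htH : t ∈ (figNetwork M ε tf' tf).H := ⟨ht0, ht.trans (hn.trans htf)⟩
  rw [hDd ⟨ht0, ht.trans hn⟩, hd.time_eq t htH]
  have h1 := τ_le_four (M := M) (tf' := tf') (tf := tf) hε hε1 e
  have h2 := hd.queue_le (τ_nonneg hε hε1 e) ht0
  have h3 := mass_le_of_le hε hε1 htf hI e hn ht
  have h4 := mul_le_of_le_one_right (hd.queue_nonneg t htH)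
    (inv_ν_le_one (M := M) (ε := ε) (tf' := tf') (tf := tf) e)
  unfold exitBound
  push_cast
  linarith

theorem arrival_le_exitBound (hε : 0 < ε) (hε1 : ε ≤ 1) (htf : tf' ≤ tf)
    (hI : (figNetwork M ε tf' tf).Induces h g D) {i : FigComm}
    (w : (figNetwork M ε tf' tf).Walk i) {n j : ℕ} (hn : ((exitBound^[j] n : ℕ) : ℝ) ≤ tf')
    (hj : j ≤ w.1.length) {s : ℝ} (hs : s ∈ Icc 0 tf) (hsn : s ≤ n) :
    arrival D w.1 j s ≤ (exitBound^[j] n : ℕ) := by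
  induction j with
  | zero => exact hsn
  | succ j ih =>
    rw [Function.iterate_succ_apply'] at hn ⊢
    have hle : ((exitBound^[j] n : ℕ) : ℝ) ≤ tf' :=
      le_trans (by exact_mod_cast le_exitBound _) hn
    rw [arrival_succ D w.1 (by omega)]
    exact exit_le_exitBound hε hε1 htf hI _ hle
      (hI.traversal.mapsTo i w j (by omega) hs).1 (ih hle (by omega))

end Crude

end FigNet

/-! ### Direct flows I: commodity 2 travels without delay. -/

namespace FigNet

theorem setIntegral_Icc_indicator {a b : ℝ} (c t : ℝ) (ha : 0 ≤ a) :
    ∫ s in Icc 0 t, (Icc a b).indicator (fun _ => c) s = c * max 0 (min t b - a) := by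
  rw [setIntegral_indicator measurableSet_Icc, Icc_inter_Icc, max_eq_right ha]
  simp [mul_comm, max_comm]

theorem max_min_sub_le {a b s t : ℝ} (hst : s ≤ t) :
    max 0 (min t b - a) - max 0 (min s b - a) ≤ t - s := by
  rcases le_total t b with h1 | h1 <;> rcases le_total s b with h2 | h2 <;>
    simp only [h1, h2, min_eq_left, min_eq_right] <;>
    rcases max_cases 0 (t - a) with h3 | h3 <;> rcases max_cases 0 (s - a) with h4 | h4 <;>
    rcases max_cases 0 (b - a) with h5 | h5 <;> linarith

section LowerBound

variable {M ε tf' tf : ℝ} {g D : FigEdge → ℝ → ℝ}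
  {h : (figNetwork M ε tf' tf).CWalk → ℝ → ℝ}

/-- The walk of the second commodity without cycles. -/
def walkC2 : (figNetwork M ε tf' tf).Walk c2 := ⟨[e5, e4, e2], rfl, rfl, rfl, rfl⟩

/-- The walk of the fourth commodity without cycles. -/
def walkC4 : (figNetwork M ε tf' tf).Walk c4 := ⟨[e1, e2, e3], rfl, rfl, rfl, rfl⟩

/-- Dropping the null set of endpoints makes later comparisons of arrival times strict. -/
theorem ae_mem_Ioo (hI : (figNetwork M ε tf' tf).Induces h g D) {i : FigComm} {a b c : ℝ}
    (hr : (figNetwork M ε tf' tf).inflow i = (Icc a b).indicator fun _ => c)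
    (w : (figNetwork M ε tf' tf).Walk i) :
    ∀ᵐ s ∂(volume.restrict (figNetwork M ε tf' tf).H),
      h ⟨i, w⟩ s ≠ 0 → s ∈ Ioo a b := by
  refine hI.ae_eq_zero i ?_ w
  have ha : ∀ᵐ s ∂(volume : Measure ℝ), s ≠ a := compl_mem_ae_iff.2 (measure_singleton a)
  have hb : ∀ᵐ s ∂(volume : Measure ℝ), s ≠ b := compl_mem_ae_iff.2 (measure_singleton b)
  filter_upwards [ae_restrict_of_ae ha, ae_restrict_of_ae hb] with s hsa hsb hs
  rw [hr]
  refine indicator_of_notMem (fun hs' => hs ⟨?_, ?_⟩) _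
  · exact lt_of_le_of_ne hs'.1 (Ne.symm hsa)
  · exact lt_of_le_of_ne hs'.2 hsb

/-- An induced flow in which the first commodity does not run through the cycle, for large `M`. -/
structure IsDirect (h : (figNetwork M ε tf' tf).CWalk → ℝ → ℝ) (g D : FigEdge → ℝ → ℝ) :
    Prop where
  ε_pos : 0 < ε
  ε_le : ε ≤ 1
  le_tf' : 13 + M ≤ tf'
  tf'_le : tf' ≤ tf
  exitBound_le : ((exitBound^[4] 5 : ℕ) : ℝ) ≤ 10 + M
  induces : (figNetwork M ε tf' tf).Induces h g D
  direct : ∀ w : (figNetwork M ε tf' tf).Walk c1, w.1 ≠ [e7] →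
    ∀ᵐ s ∂(volume.restrict (figNetwork M ε tf' tf).H), h ⟨c1, w⟩ s = 0

theorem le_exitBound_iterate : (30 : ℝ) ≤ (exitBound^[4] 5 : ℕ) := by
  have h1 : 30 ≤ exitBound 5 := by norm_num [exitBound]
  have h2 : 30 ≤ exitBound^[4] 5 :=
    h1.trans ((le_exitBound _).trans ((le_exitBound _).trans (le_exitBound _)))
  exact_mod_cast h2

theorem exitBound_iterate_mono {j k : ℕ} (hjk : j ≤ k) :
    ((exitBound^[j] 5 : ℕ) : ℝ) ≤ (exitBound^[k] 5 : ℕ) := by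
  have : exitBound^[j] 5 ≤ exitBound^[k] 5 := by
    induction k, hjk using Nat.le_induction with
    | base => exact le_rfl
    | succ k _ ih =>
      rw [Function.iterate_succ_apply']
      exact ih.trans (le_exitBound _)
  exact_mod_cast this

namespace IsDirect

theorem twenty_le (hd : IsDirect h g D) : 20 ≤ M := by
  linarith [hd.exitBound_le, le_exitBound_iterate]

theorem support (hd : IsDirect h g D) {i : FigComm} {a b c : ℝ}
    (hr : (figNetwork M ε tf' tf).inflow i = (Icc a b).indicator fun _ => c)
    (w : (figNetwork M ε tf' tf).Walk i) :
    ∀ᵐ s ∂(volume.restrict (figNetwork M ε tf' tf).H),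
      h ⟨i, w⟩ s ≠ 0 → s ∈ Ioo a b :=
  ae_mem_Ioo hd.induces hr w

theorem mem_H (hd : IsDirect h g D) {t : ℝ} (h0 : 0 ≤ t) (ht : t ≤ 13 + M) :
    t ∈ (figNetwork M ε tf' tf).H :=
  ⟨h0, ht.trans (hd.le_tf'.trans hd.tf'_le)⟩

theorem τ_le (hd : IsDirect h g D) (e : FigEdge) {t : ℝ} (h0 : 0 ≤ t) (ht : t ≤ 13 + M) :
    (figNetwork M ε tf' tf).τ e ≤ D e t :=
  hd.induces.traversal.τ_le hd.tf'_le e ⟨h0, ht.trans hd.le_tf'⟩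

theorem hasSum_setIntegral (hd : IsDirect h g D) (i : FigComm) {S : Set ℝ}
    (hS : S ⊆ (figNetwork M ε tf' tf).H) :
    HasSum (fun w : (figNetwork M ε tf' tf).Walk i => ∫ s in S, h ⟨i, w⟩ s)
      (∫ s in S, (figNetwork M ε tf' tf).inflow i s) :=
  hd.induces.hasSum_setIntegral i (integrableOn_inflow i (by simp [VickreyNetwork.H])) hS

/-- Commodities 2 and 4 start by time 5, and the second visit to `e4` on a detour of commodity 2
comes after four edges. This explains the four iterations from 5. -/
theorem arrival_le (hd : IsDirect h g D) {i : FigComm} (w : (figNetwork M ε tf' tf).Walk i)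
    {j : ℕ} (hj4 : j ≤ 4) (hj : j ≤ w.1.length) {s : ℝ} (h0 : 0 ≤ s) (hs : s ≤ 5) :
    arrival D w.1 j s ≤ (exitBound^[4] 5 : ℕ) := by
  have hM := hd.twenty_le
  refine (arrival_le_exitBound hd.ε_pos hd.ε_le hd.tf'_le hd.induces w (n := 5) ?_ hj
    (hd.mem_H h0 (by linarith)) (by simpa using hs)).trans (exitBound_iterate_mono hj4)
  exact (exitBound_iterate_mono hj4).trans (by linarith [hd.exitBound_le, hd.le_tf'])

theorem edgeMass_c1 (hd : IsDirect h g D) (w : (figNetwork M ε tf' tf).Walk c1) {e : FigEdge}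
    (he : e ≠ e7) (t : ℝ) :
    (figNetwork M ε tf' tf).edgeMass D (h ⟨c1, w⟩) w.1 e t = 0 := by
  refine edgeMass_eq_zero fun k hk hke => ?_
  by_cases hw : w.1 = [e7]
  · exfalso
    simp only [hw, List.length_cons, List.length_nil] at hk
    obtain rfl : k = 0 := by omega
    simp only [hw, List.getElem_cons_zero] at hke
    exact he hke.symm
  · refine hd.induces.traversal.arrivedMass_eq_zero w hk.le ?_
    filter_upwards [hd.direct w hw] with s hs h0
    exact absurd hs h0

theorem edgeMass_eq_zero_of_le (hd : IsDirect h g D) {i : FigComm} {a b c : ℝ}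
    (hr : (figNetwork M ε tf' tf).inflow i = (Icc a b).indicator fun _ => c)
    (w : (figNetwork M ε tf' tf).Walk i) (e : FigEdge) {t : ℝ} (ht : t ≤ a) :
    (figNetwork M ε tf' tf).edgeMass D (h ⟨i, w⟩) w.1 e t = 0 := by
  refine edgeMass_eq_zero fun k hk _ => ?_
  refine hd.induces.traversal.arrivedMass_eq_zero w hk.le ?_
  filter_upwards [hd.support hr w, ae_restrict_mem measurableSet_H] with s hs hsH h0
  exact (ht.trans_lt (hs h0).1).trans_le (hd.induces.traversal.le_arrival w hk.le hsH)

/-- Commodity 1 is absent by directness and commodities 3 to 5 start later. A second visit of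
commodity 2 happens after `2 + (2 - ε)`, hence after time 3. -/
theorem mass_e5 (hd : IsDirect h g D) {t : ℝ} (h0 : 0 ≤ t) (ht : t ≤ 3) :
    ∫ s in Icc 0 t, g e5 s = 2 * max 0 (min t 3 - 2) := by
  have hM := hd.twenty_le
  have htH := hd.mem_H h0 (by linarith)
  have hsub : Icc 0 t ⊆ (figNetwork M ε tf' tf).H := Icc_subset_Icc_right htH.2
  rw [hd.induces.mass_eq e5 htH
    (m := fun i w => if i = c2 then ∫ s in Icc 0 t, h ⟨i, w⟩ s else 0)
    (S := fun i => if i = c2 then ∫ s in Icc 0 t, (figNetwork M ε tf' tf).inflow i s else 0)]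
  · rw [FigComm.sum_univ]
    simp only [reduceCtorEq, if_false, if_true, zero_add, add_zero]
    exact setIntegral_Icc_indicator 2 t (by norm_num)
  · intro i
    split_ifs
    · exact hd.hasSum_setIntegral i hsub
    · exact hasSum_zero
  · intro i w
    cases i with
    | c1 => simpa using hd.edgeMass_c1 w (by decide) t
    | c3 => simpa using hd.edgeMass_eq_zero_of_le rfl w e5 (by linarith)
    | c4 => simpa using hd.edgeMass_eq_zero_of_le rfl w e5 (by linarith)
    | c5 => simpa using hd.edgeMass_eq_zero_of_le rfl w e5 (by linarith)
    | c2 =>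
      simp only [if_true]
      have hw0 : ∃ w', w.1 = e5 :: w' := by
        rcases walk_c2 w.2 with hw | ⟨w', hw⟩
        · exact ⟨_, hw⟩
        · exact ⟨_, hw⟩
      obtain ⟨w', hw⟩ := hw0
      have hlen : 0 < w.1.length := by simp [hw]
      rw [edgeMass_eq_arrivedMass hlen (by simp [hw]), arrivedMass_zero_eq _ htH.2]
      intro k hk hk0 _
      refine hd.induces.traversal.arrivedMass_eq_zero w hk.le ?_
      filter_upwards [hd.support (a := 2) (b := 3) rfl w, ae_restrict_mem measurableSet_H]
        with s hs hsH hne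
      obtain ⟨hs2, hs3⟩ := hs hne
      refine lt_of_lt_of_le ?_ (hd.induces.traversal.arrival_le_arrival w
        (Nat.one_le_iff_ne_zero.2 hk0) hk.le hsH)
      rw [arrival_succ D w.1 hlen]
      have h1 := hd.τ_le e5 (by linarith : 0 ≤ s) (by linarith)
      have h2 : (figNetwork M ε tf' tf).τ e5 = 2 - ε := rfl
      have h3 : w.1[0] = e5 := by simp [hw]
      have h4 : arrival D w.1 0 s = s := rfl
      rw [h3, h4]
      linarith [hd.ε_le]

/-- The inflow rate 2 of commodity 2 just equals the service rate. -/
theorem time_e5 (hd : IsDirect h g D) {t : ℝ} (h0 : 0 ≤ t) (ht : t ≤ 3) : D e5 t = 2 - ε := by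
  have hM := hd.twenty_le
  refine hd.induces.traversal.eq_τ hd.tf'_le (e := e5) (c := 2) (hd.induces.isRate_edge e5)
    (by simp [figNetwork]) (by norm_num) (τ_nonneg hd.ε_pos hd.ε_le _) (b := 3) ?_ ?_ ⟨h0, ht⟩
  · change 3 ≤ tf'
    linarith [hd.le_tf']
  · intro s t hs hst ht
    rw [hd.mass_e5 hs (hst.trans ht), hd.mass_e5 (hs.trans hst) ht, ← mul_sub]
    exact mul_le_mul_of_nonneg_left (max_min_sub_le hst) (by norm_num)

theorem walk_c2_prefix (w : (figNetwork M ε tf' tf).Walk c2) : ∃ w', w.1 = e5 :: e4 :: w' := by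
  rcases walk_c2 w.2 with hw | ⟨w', hw⟩
  · exact ⟨_, hw⟩
  · exact ⟨_, hw⟩

theorem mass_e4 (hd : IsDirect h g D) {t : ℝ} (h0 : 0 ≤ t) (ht : t ≤ 5 - ε) :
    ∫ s in Icc 0 t, g e4 s = 2 * max 0 (min (t - (2 - ε)) 3 - 2) := by
  have hM := hd.twenty_le
  have hε := hd.ε_pos
  have hε1 := hd.ε_le
  have htH := hd.mem_H h0 (by linarith)
  have hsub : Icc 0 (t - (2 - ε)) ⊆ (figNetwork M ε tf' tf).H :=
    Icc_subset_Icc_right (by linarith [htH.2])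
  rw [hd.induces.mass_eq e4 htH
    (m := fun i w => if i = c2 then ∫ s in Icc 0 (t - (2 - ε)), h ⟨i, w⟩ s else 0)
    (S := fun i => if i = c2 then
      ∫ s in Icc 0 (t - (2 - ε)), (figNetwork M ε tf' tf).inflow i s else 0)]
  · rw [FigComm.sum_univ]
    simp only [reduceCtorEq, if_false, if_true, zero_add, add_zero]
    exact setIntegral_Icc_indicator 2 _ (by norm_num)
  · intro i
    split_ifs
    · exact hd.hasSum_setIntegral i hsub
    · exact hasSum_zero
  · intro i w
    cases i with
    | c1 => simpa using hd.edgeMass_c1 w (by decide) t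
    | c3 => simpa using hd.edgeMass_eq_zero_of_le rfl w e4 (by linarith)
    | c5 => simpa using hd.edgeMass_eq_zero_of_le rfl w e4 (by linarith)
    | c4 =>
      simp only [reduceCtorEq, if_false]
      have hw0 : ∃ w', w.1 = e1 :: w' := by
        rcases walk_c4 w.2 with hw | ⟨w', hw⟩
        · exact ⟨_, hw⟩
        · exact ⟨_, hw⟩
      obtain ⟨w', hw⟩ := hw0
      have hlen : 0 < w.1.length := by simp [hw]
      have h3 : w.1[0] = e1 := by simp [hw]
      refine edgeMass_eq_zero fun k hk hke => ?_
      have hk0 : k ≠ 0 := by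
        rintro rfl
        rw [h3] at hke
        cases hke
      refine hd.induces.traversal.arrivedMass_eq_zero w hk.le ?_
      filter_upwards [hd.support (a := 4) (b := 5) rfl w, ae_restrict_mem measurableSet_H]
        with s hs hsH hne
      obtain ⟨hs2, hs3⟩ := hs hne
      refine lt_of_lt_of_le ?_ (hd.induces.traversal.arrival_le_arrival w
        (Nat.one_le_iff_ne_zero.2 hk0) hk.le hsH)
      rw [arrival_succ D w.1 hlen]
      have h1 := hd.τ_le e1 (by linarith : 0 ≤ s) (by linarith)
      have h2 : (figNetwork M ε tf' tf).τ e1 = 1 := rfl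
      have h4 : arrival D w.1 0 s = s := rfl
      rw [h3, h4]
      linarith
    | c2 =>
      simp only [if_true]
      obtain ⟨w', hw⟩ := walk_c2_prefix w
      have hlen : 1 < w.1.length := by simp [hw]
      have harr1 : ∀ s, 0 ≤ s → s ≤ 3 → arrival D w.1 1 s = s + (2 - ε) := by
        intro s hs0 hs3
        rw [arrival_succ D w.1 (by omega)]
        have h3 : w.1[0] = e5 := by simp [hw]
        have h4 : arrival D w.1 0 s = s := rfl
        rw [h3, h4, hd.time_e5 hs0 hs3]
      rw [edgeMass_eq_arrivedMass hlen (by simp [hw])]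
      · refine hd.induces.traversal.arrivedMass_eq w hlen.le measurableSet_Icc hsub ?_
        filter_upwards [hd.support (a := 2) (b := 3) rfl w] with s hs hne
        obtain ⟨hs2, hs3⟩ := hs hne
        rw [harr1 s (by linarith) hs3.le]
        exact ⟨fun h => ⟨by linarith, by linarith⟩, fun h => by linarith [h.2]⟩
      intro k hk hk1 hke
      -- Any further visit to `e4` comes after `e6`, which takes 4 time units, and so after `5 - ε`.
      have hk3 : 3 ≤ k ∧ ∃ w', w.1 = e5 :: e4 :: e6 :: w' := by
        rcases walk_c2 w.2 with hw | ⟨w', hw⟩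
        · exfalso
          have hk' : k < 3 := by simpa [hw] using hk
          simp only [hw] at hke
          interval_cases k <;> first | exact hk1 rfl | simp at hke
        · refine ⟨?_, _, hw⟩
          by_contra hk3
          simp only [hw] at hke
          have hk' : k < 3 := by omega
          interval_cases k <;> first | exact hk1 rfl | simp at hke
      obtain ⟨hk3, w', hw⟩ := hk3
      refine hd.induces.traversal.arrivedMass_eq_zero w hk.le ?_
      filter_upwards [hd.support (a := 2) (b := 3) rfl w, ae_restrict_mem measurableSet_H]
        with s hs hsH hne
      obtain ⟨hs2, hs3⟩ := hs hne
      refine lt_of_lt_of_le ?_ (hd.induces.traversal.arrival_le_arrival w hk3 hk.le hsH)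
      have ha2 := hd.arrival_le w (j := 2) (by norm_num) (by omega) (by linarith : 0 ≤ s)
        (by linarith)
      have e0 : w.1[2] = e6 := by simp [hw]
      have e1 := arrival_succ D w.1 (j := 2) (by omega) s
      have e3 := hd.induces.traversal.arrival_le_arrival w (j := 1) (k := 2) (by norm_num)
        (by omega) hsH
      rw [harr1 s (by linarith) hs3.le] at e3
      rw [e0] at e1
      have e4 := hd.τ_le e6 (t := arrival D w.1 2 s) (by linarith)
        (by linarith [hd.exitBound_le])
      have e5 : (figNetwork M ε tf' tf).τ e6 = 4 := rfl
      change t < arrival D w.1 (2 + 1) s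
      linarith

theorem time_e4 (hd : IsDirect h g D) {t : ℝ} (h0 : 0 ≤ t) (ht : t ≤ 5 - ε) : D e4 t = ε := by
  have hM := hd.twenty_le
  have hε := hd.ε_pos
  refine hd.induces.traversal.eq_τ hd.tf'_le (e := e4) (c := 2) (hd.induces.isRate_edge e4)
    (by simp [figNetwork]) (by norm_num) (τ_nonneg hd.ε_pos hd.ε_le _) (b := 5 - ε) ?_ ?_ ⟨h0, ht⟩
  · change 5 - ε ≤ tf'
    linarith [hd.le_tf']
  · intro s t hs hst ht
    rw [hd.mass_e4 hs (hst.trans ht), hd.mass_e4 (hs.trans hst) ht, ← mul_sub]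
    refine mul_le_mul_of_nonneg_left ?_ (by norm_num)
    have := max_min_sub_le (a := 2) (b := 3) (by linarith : s - (2 - ε) ≤ t - (2 - ε))
    linarith

theorem arrival_c2 (hd : IsDirect h g D) (w : (figNetwork M ε tf' tf).Walk c2) {s : ℝ}
    (h0 : 0 ≤ s) (hs : s ≤ 3) : arrival D w.1 2 s = s + 2 := by
  obtain ⟨w', hw⟩ := walk_c2_prefix w
  have hε := hd.ε_le
  have h1 : arrival D w.1 2 s = s + D e5 s + D e4 (s + D e5 s) := by
    rw [hw]
    rfl
  rw [h1, hd.time_e5 h0 hs, hd.time_e4 (by linarith) (by linarith)]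
  ring

end IsDirect

end LowerBound

end FigNet

/-! ### Direct flows II: persistent queues on `e3` or `e4` and the lower bound on the cost. -/

namespace FigNet

section LowerBound

variable {M ε tf' tf : ℝ} {g D : FigEdge → ℝ → ℝ}
  {h : (figNetwork M ε tf' tf).CWalk → ℝ → ℝ}

/-- The volume of the walk inflow into the walk `w` of commodity `i`. -/
noncomputable def walkMass (h : (figNetwork M ε tf' tf).CWalk → ℝ → ℝ) (i : FigComm)
    (w : (figNetwork M ε tf' tf).Walk i) : ℝ :=
  ∫ s in (figNetwork M ε tf' tf).H, h ⟨i, w⟩ s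

namespace IsDirect

theorem walkMass_nonneg (hd : IsDirect h g D) {i : FigComm}
    (w : (figNetwork M ε tf' tf).Walk i) : 0 ≤ walkMass h i w :=
  integral_nonneg_of_ae (hd.induces.isRate_walk ⟨i, w⟩).2

theorem hasSum_walkMass (hd : IsDirect h g D) {i : FigComm} {a b c : ℝ}
    (hr : (figNetwork M ε tf' tf).inflow i = (Icc a b).indicator fun _ => c)
    (ha : 0 ≤ a) (hab : a ≤ b) (hb : b ≤ 13 + M) :
    HasSum (walkMass h i) (c * (b - a)) := by
  have h1 := hd.hasSum_setIntegral i (S := (figNetwork M ε tf' tf).H) subset_rfl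
  have h2 : ∫ s in (figNetwork M ε tf' tf).H, (figNetwork M ε tf' tf).inflow i s =
      c * (b - a) := by
    rw [hr, VickreyNetwork.H, setIntegral_Icc_indicator _ _ ha, min_eq_right,
      max_eq_right (by linarith)]
    exact hb.trans (hd.le_tf'.trans hd.tf'_le)
  rw [h2] at h1
  exact h1

theorem walkMass_le (hd : IsDirect h g D) {i : FigComm} {a b c : ℝ}
    (hr : (figNetwork M ε tf' tf).inflow i = (Icc a b).indicator fun _ => c)
    (ha : 0 ≤ a) (hab : a ≤ b) (hb : b ≤ 13 + M) (w : (figNetwork M ε tf' tf).Walk i) :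
    walkMass h i w ≤ c * (b - a) :=
  le_hasSum (hd.hasSum_walkMass hr ha hab hb) w fun w' _ => hd.walkMass_nonneg w'

/-- If a walk reaches `e` with its edge of index `j` during `(t₁, t₂]`, then its whole volume does
so. -/
theorem walkMass_le_edgeMass_sub (hd : IsDirect h g D) {i : FigComm} {a b c : ℝ}
    (hr : (figNetwork M ε tf' tf).inflow i = (Icc a b).indicator fun _ => c)
    (w : (figNetwork M ε tf' tf).Walk i) {j : ℕ} (hj : j < w.1.length) {e : FigEdge}
    (he : w.1[j] = e) {t₁ t₂ : ℝ} (ht : t₁ ≤ t₂)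
    (harr : ∀ s ∈ Ioo a b, arrival D w.1 j s ∈ Ioc t₁ t₂) :
    walkMass h i w ≤ (figNetwork M ε tf' tf).edgeMass D (h ⟨i, w⟩) w.1 e t₂ -
      (figNetwork M ε tf' tf).edgeMass D (h ⟨i, w⟩) w.1 e t₁ := by
  refine le_trans (le_of_eq ?_)
    ((hd.induces.isRate_walk ⟨i, w⟩).arrivedMass_sub_le_edgeMass_sub hj he ht)
  rw [hd.induces.traversal.arrivedMass_eq_mass w hj.le,
    hd.induces.traversal.arrivedMass_eq_zero w hj.le, sub_zero]
  · rfl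
  · filter_upwards [hd.support hr w] with s hs h0 using (harr s (hs h0)).1
  · filter_upwards [hd.support hr w] with s hs h0 using (harr s (hs h0)).2

theorem edgeMass_sub_nonneg (hd : IsDirect h g D) {i : FigComm}
    (w : (figNetwork M ε tf' tf).Walk i) (e : FigEdge) {t₁ t₂ : ℝ} (ht : t₁ ≤ t₂) :
    0 ≤ (figNetwork M ε tf' tf).edgeMass D (h ⟨i, w⟩) w.1 e t₂ -
      (figNetwork M ε tf' tf).edgeMass D (h ⟨i, w⟩) w.1 e t₁ :=
  sub_nonneg.2 ((hd.induces.isRate_walk ⟨i, w⟩).edgeMass_mono ht)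

/-- The inflow into the first edge of a walk. -/
theorem sub_le_edgeMass_sub (hd : IsDirect h g D) {i : FigComm}
    (w : (figNetwork M ε tf' tf).Walk i) (hj : 0 < w.1.length) {e : FigEdge}
    (he : w.1[0] = e) {t₁ t₂ : ℝ} (ht : t₁ ≤ t₂) (ht₂ : t₂ ≤ tf) :
    (∫ s in Icc 0 t₂, h ⟨i, w⟩ s) - (∫ s in Icc 0 t₁, h ⟨i, w⟩ s) ≤
      (figNetwork M ε tf' tf).edgeMass D (h ⟨i, w⟩) w.1 e t₂ -
      (figNetwork M ε tf' tf).edgeMass D (h ⟨i, w⟩) w.1 e t₁ := by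
  rw [← arrivedMass_zero_eq (N := figNetwork M ε tf' tf) (D := D) w.1 ht₂,
    ← arrivedMass_zero_eq (N := figNetwork M ε tf' tf) (D := D) w.1 (ht.trans ht₂)]
  exact (hd.induces.isRate_walk ⟨i, w⟩).arrivedMass_sub_le_edgeMass_sub hj he ht

theorem arrival_one_c4 (D : FigEdge → ℝ → ℝ) (w : (figNetwork M ε tf' tf).Walk c4) (s : ℝ) :
    arrival D w.1 1 s = s + D e1 s := by
  rcases walk_c4 w.2 with hw | ⟨w', hw⟩ <;> rw [hw] <;> rfl

theorem five_le_arrival_c4 (hd : IsDirect h g D) {s : ℝ} (hs : s ∈ Icc 4 5) :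
    s + 1 ≤ s + D e1 s := by
  have := hd.twenty_le
  have h1 := hd.τ_le e1 (by linarith [hs.1] : 0 ≤ s) (by linarith [hs.2])
  have h2 : (figNetwork M ε tf' tf).τ e1 = 1 := rfl
  linarith

open Classical in
-- Commodity 2 on `walkC2` arrives at `e2` during `[4, 5]`, before commodity 4. By first-in
-- first-out on `e1`, a particle of commodity 4 departing at `s` has behind it none of those that
-- departed earlier.
theorem le_mass_e2 (hd : IsDirect h g D) {s : ℝ} (hs : s ∈ Icc 4 5) :
    walkMass h c2 walkC2 + ∫ u in Icc 0 s, h ⟨c4, walkC4⟩ u ≤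
      (∫ u in Icc 0 (s + D e1 s), g e2 u) - ∫ u in Icc 0 4, g e2 u := by
  have hM := hd.twenty_le
  have hα5 := hd.five_le_arrival_c4 hs
  have hs4 := hs.1
  have hs5 := hs.2
  have hαK : s + D e1 s ≤ (exitBound^[4] 5 : ℕ) := by
    rw [← arrival_one_c4 D (walkC4 (M := M) (ε := ε) (tf' := tf') (tf := tf)) s]
    exact hd.arrival_le _ (by norm_num) (by simp [walkC4]) (by linarith) hs.2
  have hK := hd.exitBound_le
  have hsH : s ∈ (figNetwork M ε tf' tf).H := hd.mem_H (by linarith) (by linarith)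
  have key := hd.induces.le_mass_sub e2 (t₁ := 4) (t₂ := s + D e1 s)
    (hd.mem_H (by norm_num) (by linarith)) (hd.mem_H (by linarith) (by linarith))
    (m := fun i => match i with
      | .c2 => fun w => if w = walkC2 then walkMass h c2 walkC2 else 0
      | .c4 => fun w => if w = walkC4 then ∫ u in Icc 0 s, h ⟨c4, walkC4⟩ u else 0
      | _ => fun _ => 0)
    (S := fun i => match i with
      | .c2 => walkMass h c2 walkC2
      | .c4 => ∫ u in Icc 0 s, h ⟨c4, walkC4⟩ u
      | _ => 0) ?_ ?_
  · rw [FigComm.sum_univ] at key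
    linarith
  · intro i
    cases i with
    | c2 => exact hasSum_ite_eq _ _
    | c4 => exact hasSum_ite_eq _ _
    | _ => exact hasSum_zero
  · intro i w
    cases i with
    | c2 =>
      dsimp only
      split_ifs with hw
      · subst hw
        refine hd.walkMass_le_edgeMass_sub (a := 2) (b := 3) rfl walkC2 (j := 2)
          (by simp [walkC2]) rfl (by linarith) fun u hu => ?_
        rw [hd.arrival_c2 _ (by linarith [hu.1]) hu.2.le]
        exact ⟨by linarith [hu.1], by linarith [hu.2]⟩
      · exact hd.edgeMass_sub_nonneg w e2 (by linarith)
    | c4 =>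
      dsimp only
      split_ifs with hw
      · subst hw
        have hlen : 1 < (walkC4 (M := M) (ε := ε) (tf' := tf') (tf := tf)).1.length := by
          simp [walkC4]
        refine le_trans ?_ ((hd.induces.isRate_walk ⟨c4, walkC4⟩).arrivedMass_sub_le_edgeMass_sub
          (j := 1) hlen rfl (by linarith))
        rw [hd.induces.traversal.arrivedMass_eq_zero (t := 4) walkC4 hlen.le, sub_zero]
        · have hsub : {u ∈ (figNetwork M ε tf' tf).H |
              arrival D (walkC4 (M := M) (ε := ε) (tf' := tf') (tf := tf)).1 1 u ∈
                Icc 0 (s + D e1 s)} ⊆ (figNetwork M ε tf' tf).H := fun u hu => hu.1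
          refine setIntegral_mono_set ((hd.induces.isRate_walk ⟨c4, walkC4⟩).1.mono_set hsub)
            (ae_restrict_of_ae_restrict_of_subset hsub
              (hd.induces.isRate_walk ⟨c4, walkC4⟩).2) (LE.le.eventuallyLE fun u hu => ?_)
          have huH : u ∈ (figNetwork M ε tf' tf).H := ⟨hu.1, hu.2.trans hsH.2⟩
          refine ⟨huH, ?_⟩
          rw [arrival_one_c4]
          exact ⟨add_nonneg hu.1 (hd.induces.traversal.nonneg e1 u huH),
            hd.induces.traversal.fifo e1 huH hsH hu.2⟩
        · filter_upwards [hd.support (a := 4) (b := 5) rfl walkC4] with u hu h0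
          rw [arrival_one_c4]
          obtain ⟨hu1, hu2⟩ := hu h0
          linarith [hd.five_le_arrival_c4 ⟨hu1.le, hu2.le⟩]
      · exact hd.edgeMass_sub_nonneg w e2 (by linarith)
    | _ => exact hd.edgeMass_sub_nonneg w e2 (by linarith)

/-- From time 4 on, `e2` needs one unit of time per unit of volume, plus 1 for the traversal. The
arrival time at `e2` cancels, so delays on `e1` are irrelevant. -/
theorem le_arrival_two_c4 (hd : IsDirect h g D) {s : ℝ} (hs : s ∈ Icc 4 5) :
    5 + walkMass h c2 walkC2 + ∫ u in Icc 0 s, h ⟨c4, walkC4⟩ u ≤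
      arrival D (walkC4 (M := M) (ε := ε) (tf' := tf') (tf := tf)).1 2 s := by
  have hM := hd.twenty_le
  have h1 := hd.le_mass_e2 hs
  have hα5 := hd.five_le_arrival_c4 hs
  have hs4 := hs.1
  have hs5 := hs.2
  have hαK : s + D e1 s ≤ (exitBound^[4] 5 : ℕ) := by
    rw [← arrival_one_c4 D (walkC4 (M := M) (ε := ε) (tf' := tf') (tf := tf)) s]
    exact hd.arrival_le _ (by norm_num) (by simp [walkC4]) (by linarith) hs.2
  have h2 := hd.induces.traversal.le_time hd.tf'_le (e := e2) (c := 1) (by simp [figNetwork])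
    one_pos (τ_nonneg hd.ε_pos hd.ε_le _) (s := 4) (t := s + D e1 s) (by norm_num) (by linarith)
    (by change s + D e1 s ≤ tf'; linarith [hd.exitBound_le, hd.le_tf'])
  have h3 : (figNetwork M ε tf' tf).τ e2 = 1 := rfl
  have h4 : arrival D (walkC4 (M := M) (ε := ε) (tf' := tf') (tf := tf)).1 2 s =
    s + D e1 s + D e2 (s + D e1 s) := rfl
  rw [h3, div_one, one_mul] at h2
  rw [h4]
  linarith

/-- The volume of the fourth commodity that gets past the queue of `e2` up to time `7`. -/
theorem arrivedMass_c4_le (hd : IsDirect h g D) :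
    (figNetwork M ε tf' tf).arrivedMass D (h ⟨c4, walkC4⟩)
      (walkC4 (M := M) (ε := ε) (tf' := tf') (tf := tf)).1 2 7 ≤
      2 - walkMass h c2 walkC2 := by
  have hM := hd.twenty_le
  have hlen : 2 ≤ (walkC4 (M := M) (ε := ε) (tf' := tf') (tf := tf)).1.length := by
    simp [walkC4]
  have ha : walkMass h c2 walkC2 ≤ 2 * (3 - 2) :=
    hd.walkMass_le (a := 2) (b := 3) rfl (by norm_num) (by norm_num) (by linarith) walkC2
  have hsub45 : Icc (4 : ℝ) 5 ⊆ (figNetwork M ε tf' tf).H := fun s hs =>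
    hd.mem_H (by linarith [hs.1]) (by linarith [hs.2])
  have hclosed : IsClosed {s ∈ Icc (4 : ℝ) 5 |
      arrival D (walkC4 (M := M) (ε := ε) (tf' := tf') (tf := tf)).1 2 s ≤ 7} :=
    ((hd.induces.traversal.continuousOn_arrival walkC4 hlen).mono
      hsub45).preimage_isClosed_of_isClosed isClosed_Icc isClosed_Iic
  rw [hd.induces.traversal.arrivedMass_eq walkC4 hlen hclosed.measurableSet
    (fun s hs => hsub45 hs.1)]
  · rcases eq_empty_or_nonempty {s ∈ Icc (4 : ℝ) 5 |
      arrival D (walkC4 (M := M) (ε := ε) (tf' := tf') (tf := tf)).1 2 s ≤ 7} with hX | hX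
    · rw [hX]
      simp only [Measure.restrict_empty, integral_zero_measure]
      linarith
    · obtain ⟨b, hb, hmax⟩ := (isCompact_Icc.of_isClosed_subset hclosed
        fun s hs => hs.1).exists_isGreatest hX
      have h1 := hd.le_arrival_two_c4 hb.1
      have h2 := hb.2
      have hbH := hsub45 hb.1
      have hsub : Icc 0 b ⊆ (figNetwork M ε tf' tf).H := Icc_subset_Icc_right hbH.2
      have h3 : ∫ s in {s ∈ Icc (4 : ℝ) 5 |
          arrival D (walkC4 (M := M) (ε := ε) (tf' := tf') (tf := tf)).1 2 s ≤ 7},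
          h ⟨c4, walkC4⟩ s ≤ ∫ u in Icc 0 b, h ⟨c4, walkC4⟩ u := by
        refine setIntegral_mono_set ((hd.induces.isRate_walk ⟨c4, walkC4⟩).1.mono_set hsub)
          (ae_restrict_of_ae_restrict_of_subset hsub
            (hd.induces.isRate_walk ⟨c4, walkC4⟩).2) (LE.le.eventuallyLE fun u hu => ?_)
        exact ⟨by linarith [hu.1.1], hmax hu⟩
      linarith
  · filter_upwards [hd.support (a := 4) (b := 5) rfl walkC4] with u hu h0
    exact ⟨fun h7 => ⟨Ioo_subset_Icc_self (hu h0), h7⟩, fun h7 => h7.2⟩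

open Classical in
-- Commodity 3 alone uses the full capacity `t - 7`. Added to it is the part of commodity 4 that is
-- late at `e3`; with `l` the detouring volume, this excess is at least `1 - l`.
theorem le_mass_e3 (hd : IsDirect h g D) {t : ℝ} (ht : (exitBound^[4] 5 : ℕ) ≤ t)
    (htM : t ≤ 10 + M) :
    walkMass h c2 walkC2 + walkMass h c4 walkC4 - 2 + (t - 7) ≤
      (∫ u in Icc 0 t, g e3 u) - ∫ u in Icc 0 7, g e3 u := by
  have hM := hd.twenty_le
  have ht30 : 30 ≤ t := le_exitBound_iterate.trans ht
  have htH := hd.mem_H (by linarith : 0 ≤ t) (by linarith)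
  have h7H := hd.mem_H (by norm_num : (0 : ℝ) ≤ 7) (by linarith)
  have key := hd.induces.le_mass_sub e3 h7H htH
    (m := fun i => match i with
      | .c3 => fun w => (∫ s in Icc 0 t, h ⟨c3, w⟩ s) - ∫ s in Icc 0 7, h ⟨c3, w⟩ s
      | .c4 => fun w => if w = walkC4 then walkMass h c4 walkC4 - (2 - walkMass h c2 walkC2) else 0
      | _ => fun _ => 0)
    (S := fun i => match i with
      | .c3 => t - 7
      | .c4 => walkMass h c4 walkC4 - (2 - walkMass h c2 walkC2)
      | _ => 0) ?_ ?_
  · rw [FigComm.sum_univ] at key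
    linarith
  · intro i
    cases i with
    | c3 =>
      have h1 := (hd.hasSum_setIntegral c3 (S := Icc 0 t) (Icc_subset_Icc_right htH.2)).sub
        (hd.hasSum_setIntegral c3 (S := Icc 0 7) (Icc_subset_Icc_right h7H.2))
      have h2 : ∀ x, ∫ s in Icc 0 x, (figNetwork M ε tf' tf).inflow c3 s =
        1 * max 0 (min x (10 + M) - 7) := fun x => setIntegral_Icc_indicator 1 x (by norm_num)
      rw [h2, h2, min_eq_left htM, min_eq_left (by linarith : 7 ≤ 10 + M),
        max_eq_right (by linarith)] at h1
      simpa using h1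
    | c4 => exact hasSum_ite_eq _ _
    | _ => exact hasSum_zero
  · intro i w
    cases i with
    | c3 =>
      have hw := walk_c3 w.2
      exact hd.sub_le_edgeMass_sub w (by simp [hw]) (by simp [hw]) (by linarith) htH.2
    | c4 =>
      dsimp only
      split_ifs with hw
      · subst hw
        have hlen : 2 < (walkC4 (M := M) (ε := ε) (tf' := tf') (tf := tf)).1.length := by
          simp [walkC4]
        refine le_trans ?_ ((hd.induces.isRate_walk ⟨c4, walkC4⟩).arrivedMass_sub_le_edgeMass_sub
          (j := 2) hlen rfl (by linarith))
        have h1 := hd.arrivedMass_c4_le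
        rw [hd.induces.traversal.arrivedMass_eq_mass (t := t) walkC4 hlen.le]
        · change walkMass h c4 walkC4 - (2 - walkMass h c2 walkC2) ≤ walkMass h c4 walkC4 - _
          linarith
        · filter_upwards [hd.support (a := 4) (b := 5) rfl walkC4] with u hu h0
          obtain ⟨hu1, hu2⟩ := hu h0
          exact (hd.arrival_le walkC4 (by norm_num) hlen.le (by linarith) hu2.le).trans ht
      · exact hd.edgeMass_sub_nonneg w e3 (by linarith)
    | _ => exact hd.edgeMass_sub_nonneg w e3 (by linarith)

/-- The second arrival at `e4` is at `s + 2 + 4 + (2 - ε)` or later, and `s > 2`, `ε ≤ 1`. The time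
9 is when commodity 5 starts to use `e4` at full capacity. -/
theorem arrival_loop_c2 (hd : IsDirect h g D) (w : (figNetwork M ε tf' tf).Walk c2)
    {w' : List FigEdge} (hw : w.1 = e5 :: e4 :: e6 :: e5 :: e4 :: w') {s : ℝ}
    (hs : s ∈ Ioo 2 3) : 9 < arrival D w.1 4 s := by
  obtain ⟨hs2, hs3⟩ := hs
  have hM := hd.twenty_le
  have hK := hd.exitBound_le
  have hlen : 4 < w.1.length := by simp [hw]
  have h1 := hd.arrival_c2 w (by linarith : 0 ≤ s) hs3.le
  have h2 : arrival D w.1 3 s = arrival D w.1 2 s + D e6 (arrival D w.1 2 s) := by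
    rw [arrival_succ D w.1 (by omega)]
    simp [hw]
  have h3 : arrival D w.1 4 s = arrival D w.1 3 s + D e5 (arrival D w.1 3 s) := by
    rw [arrival_succ D w.1 (by omega)]
    simp [hw]
  have h4 := hd.arrival_le w (j := 3) (by norm_num) (by omega) (by linarith : 0 ≤ s) (by linarith)
  have h5 := hd.τ_le e6 (t := arrival D w.1 2 s) (by linarith) (by linarith)
  have h6 : (figNetwork M ε tf' tf).τ e6 = 4 := rfl
  have h7 := hd.τ_le e5 (t := arrival D w.1 3 s) (by linarith) (by linarith)
  have h8 : (figNetwork M ε tf' tf).τ e5 = 2 - ε := rfl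
  linarith [hd.ε_le]

theorem arrival_loop_c4 (hd : IsDirect h g D) (w : (figNetwork M ε tf' tf).Walk c4)
    {w' : List FigEdge} (hw : w.1 = e1 :: e6 :: e5 :: e4 :: w') {s : ℝ}
    (hs : s ∈ Ioo 4 5) : 9 < arrival D w.1 3 s := by
  obtain ⟨hs2, hs3⟩ := hs
  have hM := hd.twenty_le
  have hK := hd.exitBound_le
  have hlen : 3 < w.1.length := by simp [hw]
  have h1 := hd.five_le_arrival_c4 ⟨hs2.le, hs3.le⟩
  rw [← arrival_one_c4 D w s] at h1
  have h2 : arrival D w.1 2 s = arrival D w.1 1 s + D e6 (arrival D w.1 1 s) := by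
    rw [arrival_succ D w.1 (by omega)]
    simp [hw]
  have h3 := hd.arrival_le w (j := 1) (by norm_num) (by omega) (by linarith : 0 ≤ s) (by linarith)
  have h4 := hd.induces.traversal.arrival_le_arrival w (j := 2) (k := 3) (by norm_num)
    (by omega) (hd.mem_H (by linarith : 0 ≤ s) (by linarith))
  have h5 := hd.τ_le e6 (t := arrival D w.1 1 s) (by linarith) (by linarith)
  have h6 : (figNetwork M ε tf' tf).τ e6 = 4 := rfl
  linarith

open Classical in
-- Commodity 5 alone uses the full capacity `2 * (t - 9)`, and everything that takes the detour
-- comes on top. Of the total volume 3 of commodities 2 and 4, this is what avoids `walkC2` and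
-- `walkC4`.
theorem le_mass_e4 (hd : IsDirect h g D) {t : ℝ} (ht : (exitBound^[4] 5 : ℕ) ≤ t)
    (htM : t ≤ 13 + M) :
    3 - walkMass h c2 walkC2 - walkMass h c4 walkC4 + 2 * (t - 9) ≤
      (∫ u in Icc 0 t, g e4 u) - ∫ u in Icc 0 9, g e4 u := by
  have hM := hd.twenty_le
  have ht30 : 30 ≤ t := le_exitBound_iterate.trans ht
  have htH := hd.mem_H (by linarith : 0 ≤ t) (by linarith)
  have h9H := hd.mem_H (by norm_num : (0 : ℝ) ≤ 9) (by linarith)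
  have key := hd.induces.le_mass_sub e4 h9H htH
    (m := fun i => match i with
      | .c2 => fun w => if w = walkC2 then 0 else walkMass h c2 w
      | .c4 => fun w => if w = walkC4 then 0 else walkMass h c4 w
      | .c5 => fun w => (∫ s in Icc 0 t, h ⟨c5, w⟩ s) - ∫ s in Icc 0 9, h ⟨c5, w⟩ s
      | _ => fun _ => 0)
    (S := fun i => match i with
      | .c2 => 2 * (3 - 2) - walkMass h c2 walkC2
      | .c4 => 1 * (5 - 4) - walkMass h c4 walkC4
      | .c5 => 2 * (t - 9)
      | _ => 0) ?_ ?_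
  · rw [FigComm.sum_univ] at key
    linarith
  · intro i
    cases i with
    | c2 => exact hasSum_ite_ne (hd.hasSum_walkMass (i := c2) rfl (by norm_num) (by norm_num)
        (by linarith)) _
    | c4 => exact hasSum_ite_ne (hd.hasSum_walkMass (i := c4) rfl (by norm_num) (by norm_num)
        (by linarith)) _
    | c5 =>
      have h1 := (hd.hasSum_setIntegral c5 (S := Icc 0 t) (Icc_subset_Icc_right htH.2)).sub
        (hd.hasSum_setIntegral c5 (S := Icc 0 9) (Icc_subset_Icc_right h9H.2))
      have h2 : ∀ x, ∫ s in Icc 0 x, (figNetwork M ε tf' tf).inflow c5 s =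
        2 * max 0 (min x (13 + M) - 9) := fun x => setIntegral_Icc_indicator 2 x (by norm_num)
      rw [h2, h2, min_eq_left htM, min_eq_left (by linarith : 9 ≤ 13 + M),
        max_eq_right (by linarith)] at h1
      simpa using h1
    | _ => exact hasSum_zero
  · intro i w
    cases i with
    | c5 =>
      obtain ⟨w', hw⟩ := walk_c5 w.2
      exact hd.sub_le_edgeMass_sub w (by simp [hw]) (by simp [hw]) (by linarith) htH.2
    | c2 =>
      dsimp only
      split_ifs with hw
      · exact hd.edgeMass_sub_nonneg w e4 (by linarith)
      · obtain hw' | ⟨w', hw'⟩ := walk_c2 w.2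
        · exact absurd (Subtype.ext hw') hw
        · refine hd.walkMass_le_edgeMass_sub (a := 2) (b := 3) rfl w (j := 4)
            (by simp [hw']) (by simp [hw']) (by linarith) fun s hs =>
            ⟨hd.arrival_loop_c2 w hw' hs, ?_⟩
          exact (hd.arrival_le w le_rfl (by simp [hw']) (by linarith [hs.1])
            (by linarith [hs.2])).trans ht
    | c4 =>
      dsimp only
      split_ifs with hw
      · exact hd.edgeMass_sub_nonneg w e4 (by linarith)
      · obtain hw' | ⟨w', hw'⟩ := walk_c4 w.2
        · exact absurd (Subtype.ext hw') hw
        · refine hd.walkMass_le_edgeMass_sub (a := 4) (b := 5) rfl w (j := 3)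
            (by simp [hw']) (by simp [hw']) (by linarith) fun s hs =>
            ⟨hd.arrival_loop_c4 w hw' hs, ?_⟩
          exact (hd.arrival_le w (by norm_num) (by simp [hw']) (by linarith [hs.1])
            (by linarith [hs.2])).trans ht
    | _ => exact hd.edgeMass_sub_nonneg w e4 (by linarith)

/-- Between two times, the inflow into an edge is at least that of a commodity all of whose walks
start with this edge. -/
theorem le_mass_sub_of_head (hd : IsDirect h g D) (i : FigComm) (e : FigEdge) {a b c : ℝ}
    (hr : (figNetwork M ε tf' tf).inflow i = (Icc a b).indicator fun _ => c)
    (hw : ∀ w : (figNetwork M ε tf' tf).Walk i, ∃ w', w.1 = e :: w') (ha : 0 ≤ a)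
    {t₁ t₂ : ℝ} (h₁ : a ≤ t₁) (h₁₂ : t₁ ≤ t₂) (h₂ : t₂ ≤ b) (hb : b ≤ 13 + M) :
    c * (t₂ - t₁) ≤ (∫ u in Icc 0 t₂, g e u) - ∫ u in Icc 0 t₁, g e u := by
  have ht₁ := hd.mem_H (by linarith : 0 ≤ t₁) (by linarith)
  have ht₂ := hd.mem_H (by linarith : 0 ≤ t₂) (by linarith)
  have key := hd.induces.le_mass_sub e ht₁ ht₂
    (m := fun i' w => if i' = i then
      (∫ s in Icc 0 t₂, h ⟨i', w⟩ s) - ∫ s in Icc 0 t₁, h ⟨i', w⟩ s else 0)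
    (S := fun i' => if i' = i then c * (t₂ - t₁) else 0) ?_ ?_
  · simpa using key
  · intro i'
    split_ifs with hi
    · subst hi
      have h1 := (hd.hasSum_setIntegral i' (S := Icc 0 t₂) (Icc_subset_Icc_right ht₂.2)).sub
        (hd.hasSum_setIntegral i' (S := Icc 0 t₁) (Icc_subset_Icc_right ht₁.2))
      rw [hr, setIntegral_Icc_indicator _ _ ha, setIntegral_Icc_indicator _ _ ha, min_eq_left h₂,
        min_eq_left (h₁₂.trans h₂), max_eq_right (by linarith), max_eq_right (by linarith)] at h1
      have h2 : c * (t₂ - t₁) = c * (t₂ - a) - c * (t₁ - a) := by ring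
      rw [h2]
      exact h1
    · exact hasSum_zero
  · intro i' w
    split_ifs with hi
    · subst hi
      obtain ⟨w', hw'⟩ := hw w
      exact hd.sub_le_edgeMass_sub w (by simp [hw']) (by simp [hw']) h₁₂ ht₂.2
    · exact hd.edgeMass_sub_nonneg w e h₁₂

/-- An edge that lies on all walks of some commodities carries at least their volume. -/
theorem le_mass_of_mem (hd : IsDirect h g D) (e : FigEdge) (S : FigComm → ℝ)
    (hS : ∀ i, S i = 0 ∨ HasSum (walkMass h i) (S i) ∧
      ∀ w : (figNetwork M ε tf' tf).Walk i, e ∈ w.1) :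
    ∑ i, S i ≤ ∫ u in (figNetwork M ε tf' tf).H, g e u := by
  have hM := hd.twenty_le
  have htf : tf ∈ (figNetwork M ε tf' tf).H :=
    ⟨by linarith [hd.le_tf', hd.tf'_le], le_rfl⟩
  refine hd.induces.le_mass e htf (m := fun i w => if S i = 0 then 0 else walkMass h i w) ?_ ?_
  · intro i
    split_ifs with hi
    · rw [hi]
      exact hasSum_zero
    · exact ((hS i).resolve_left hi).1
  · intro i w
    split_ifs with hi
    · exact (hd.induces.isRate_walk ⟨i, w⟩).edgeMass_nonneg
    · obtain ⟨j, hj, hje⟩ := List.getElem_of_mem (((hS i).resolve_left hi).2 w)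
      refine le_trans (le_of_eq ?_)
        ((hd.induces.isRate_walk ⟨i, w⟩).arrivedMass_le_edgeMass hj hje tf)
      exact (hd.induces.traversal.arrivedMass_tf w hj.le).symm

end IsDirect

/-- No other edge enters the node set `{s3d2, d3d4}` from outside. -/
theorem e2_mem {w : List FigEdge} {v v' : FigNode} (hw : (figNetwork M ε tf' tf).IsWalk v w v')
    (hv : v ≠ s3d2) (hv' : v ≠ d3d4) (hv'' : v' = s3d2 ∨ v' = d3d4) : e2 ∈ w := by
  induction w generalizing v with
  | nil =>
    cases hw
    rcases hv'' with rfl | rfl <;> contradiction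
  | cons e w ih =>
    by_cases he : e = e2
    · simp [he]
    · refine List.mem_cons_of_mem _ (ih hw.2 ?_ ?_)
      · cases e <;> simp_all [figNetwork]
      · obtain ⟨h1, _⟩ := hw
        cases e <;> simp_all [figNetwork]

theorem e3_mem {w : List FigEdge} {v : FigNode} (hw : (figNetwork M ε tf' tf).IsWalk v w d3d4)
    (hv : v ≠ d3d4) : e3 ∈ w := by
  induction w generalizing v with
  | nil => exact absurd hw hv
  | cons e w ih =>
    by_cases he : e = e3
    · simp [he]
    · refine List.mem_cons_of_mem _ (ih hw.2 ?_)
      cases e <;> simp_all [figNetwork]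

namespace IsDirect

/-- In a flow in which the first commodity avoids the cycle, the total travel time is large, for
whatever traversal times the edge flow has. -/
theorem le_pairing (hd : IsDirect h g D) {D₀ : FigEdge → ℝ → ℝ}
    (hD₀ : (figNetwork M ε tf' tf).IsTraversalTime g D₀) :
    14 - 2 * ε + ε * (10 + 2 * M) + ε * (4 + M) + (10 + M - (exitBound^[4] 5 : ℕ)) ≤
      (figNetwork M ε tf' tf).pairing D₀ g := by
  have hM := hd.twenty_le
  have hε := hd.ε_pos
  have hε1 := hd.ε_le
  have hK := hd.exitBound_le
  have hK30 := le_exitBound_iterate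
  have htf1 := hd.le_tf'
  have htf2 := hd.tf'_le
  have m1 : HasSum (walkMass h c1) (6 * (1 - 0)) :=
    hd.hasSum_walkMass rfl (by norm_num) (by norm_num) (by linarith)
  have m2 : HasSum (walkMass h c2) (2 * (3 - 2)) :=
    hd.hasSum_walkMass rfl (by norm_num) (by norm_num) (by linarith)
  have m3 : HasSum (walkMass h c3) (1 * (10 + M - 7)) :=
    hd.hasSum_walkMass rfl (by norm_num) (by linarith) (by linarith)
  have m4 : HasSum (walkMass h c4) (1 * (5 - 4)) :=
    hd.hasSum_walkMass rfl (by norm_num) (by norm_num) (by linarith)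
  have m5 : HasSum (walkMass h c5) (2 * (13 + M - 9)) :=
    hd.hasSum_walkMass rfl (by norm_num) (by linarith) (by linarith)
  have g1 := hd.le_mass_of_mem e1 (fun i => match i with | .c4 => 1 * (5 - 4) | _ => 0) (by
    intro i
    cases i with
    | c4 =>
      refine Or.inr ⟨m4, fun w => ?_⟩
      rcases walk_c4 w.2 with hw | ⟨w', hw⟩ <;> simp [hw]
    | _ => exact Or.inl rfl)
  have g2 := hd.le_mass_of_mem e2
    (fun i => match i with | .c2 => 2 * (3 - 2) | .c4 => 1 * (5 - 4) | _ => 0) (by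
    intro i
    cases i with
    | c2 => exact Or.inr ⟨m2, fun w => e2_mem w.2 nofun nofun (Or.inl rfl)⟩
    | c4 => exact Or.inr ⟨m4, fun w => e2_mem w.2 nofun nofun (Or.inr rfl)⟩
    | _ => exact Or.inl rfl)
  have g3 := hd.le_mass_of_mem e3
    (fun i => match i with | .c3 => 1 * (10 + M - 7) | .c4 => 1 * (5 - 4) | _ => 0) (by
    intro i
    cases i with
    | c3 => exact Or.inr ⟨m3, fun w => e3_mem w.2 nofun⟩
    | c4 => exact Or.inr ⟨m4, fun w => e3_mem w.2 nofun⟩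
    | _ => exact Or.inl rfl)
  have g4 := hd.le_mass_of_mem e4
    (fun i => match i with | .c2 => 2 * (3 - 2) | .c5 => 2 * (13 + M - 9) | _ => 0) (by
    intro i
    cases i with
    | c2 =>
      refine Or.inr ⟨m2, fun w => ?_⟩
      rcases walk_c2 w.2 with hw | ⟨w', hw⟩ <;> simp [hw]
    | c5 =>
      refine Or.inr ⟨m5, fun w => ?_⟩
      obtain ⟨w', hw⟩ := walk_c5 w.2
      simp [hw]
    | _ => exact Or.inl rfl)
  have g5 := hd.le_mass_of_mem e5 (fun i => match i with | .c2 => 2 * (3 - 2) | _ => 0) (by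
    intro i
    cases i with
    | c2 =>
      refine Or.inr ⟨m2, fun w => ?_⟩
      rcases walk_c2 w.2 with hw | ⟨w', hw⟩ <;> simp [hw]
    | _ => exact Or.inl rfl)
  have g6 := hd.le_mass_of_mem e6 (fun _ => 0) (fun _ => Or.inl rfl)
  have g7 := hd.le_mass_of_mem e7 (fun i => match i with | .c1 => 6 * (1 - 0) | _ => 0) (by
    intro i
    cases i with
    | c1 =>
      refine Or.inr ⟨m1, fun w => ?_⟩
      rcases walk_c1 w.2 with hw | ⟨w', hw⟩ <;> simp [hw]
    | _ => exact Or.inl rfl)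
  rw [FigComm.sum_univ] at g1 g2 g3 g4 g5 g6 g7
  have hfree : ∀ e, (figNetwork M ε tf' tf).τ e *
      (∫ t in (figNetwork M ε tf' tf).H, g e t) ≤
      ∫ t in (figNetwork M ε tf' tf).H, D₀ e t * g e t := by
    intro e
    have := hD₀.le_integral_mul hd.tf'_le (hd.induces.isRate_edge e) (hd.induces.support e)
      (x := 0) (y := 0) (δ := 0) le_rfl le_rfl (by change 0 ≤ tf; linarith) (by simp)
    simpa using this
  have f1 := hfree e1
  have f2 := hfree e2
  have f5 := hfree e5
  have f6 := hfree e6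
  have f7 := hfree e7
  -- The volume of commodities 2 and 4 that takes the detour.
  obtain ⟨l, hl⟩ : ∃ l, l = 3 - walkMass h c2 walkC2 - walkMass h c4 walkC4 := ⟨_, rfl⟩
  have hl0 : 0 ≤ l := by
    have h1 := hd.walkMass_le (a := 2) (b := 3) rfl (by norm_num) (by norm_num) (by linarith)
      walkC2
    have h2 := hd.walkMass_le (a := 4) (b := 5) rfl (by norm_num) (by norm_num) (by linarith)
      walkC4
    linarith
  -- A queue of volume `l` at service rate 2 is a delay of `l / 2`.
  have f4 := hD₀.le_integral_mul hd.tf'_le (hd.induces.isRate_edge e4) (hd.induces.support e4)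
      (x := (exitBound^[4] 5 : ℕ)) (y := 13 + M) (δ := l / 2) (by linarith) (by linarith)
      (by change 13 + M ≤ tf; linarith) (by
        intro t ht
        have h1 := hD₀.le_time hd.tf'_le (e := e4) (c := 2) (by simp [figNetwork])
          (by norm_num) (τ_nonneg hε hε1 _) (s := 9) (t := t) (by norm_num) (by linarith [ht.1])
          (by change t ≤ tf'; linarith [ht.2])
        have h2 := hd.le_mass_e4 ht.1.le ht.2
        linarith)
  have w4 := hd.le_mass_sub_of_head c5 e4 rfl (fun w => walk_c5 w.2) (by norm_num)
    (by linarith : 9 ≤ ((exitBound^[4] 5 : ℕ) : ℝ)) (by linarith) (le_refl (13 + M)) le_rfl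
  have w3 := hd.le_mass_sub_of_head c3 e3 rfl (fun w => ⟨[], walk_c3 w.2⟩) (by norm_num)
    (by linarith : 7 ≤ ((exitBound^[4] 5 : ℕ) : ℝ)) (by linarith) (le_refl (10 + M))
    (by linarith)
  -- The maximum is needed because `l` can be as large as 3.
  have f3 := hD₀.le_integral_mul hd.tf'_le (hd.induces.isRate_edge e3) (hd.induces.support e3)
      (x := (exitBound^[4] 5 : ℕ)) (y := 10 + M) (δ := max 0 (1 - l)) (by linarith) (by linarith)
      (by change 10 + M ≤ tf; linarith) (by
        intro t ht
        have h1 := hD₀.le_time hd.tf'_le (e := e3) (c := 1) (by simp [figNetwork])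
          (by norm_num) (τ_nonneg hε hε1 _) (s := 7) (t := t) (by norm_num) (by linarith [ht.1])
          (by change t ≤ tf'; linarith [ht.2])
        have h2 := hd.le_mass_e3 ht.1.le ht.2
        have h3 := hD₀.τ_le hd.tf'_le e3 (t := t)
          ⟨by linarith [ht.1], by change t ≤ tf'; linarith [ht.2]⟩
        rcases max_cases 0 (1 - l) with hm | hm <;> linarith)
  have t1 : (figNetwork M ε tf' tf).τ e1 = 1 := rfl
  have t2 : (figNetwork M ε tf' tf).τ e2 = 1 := rfl
  have t3 : (figNetwork M ε tf' tf).τ e3 = ε := rfl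
  have t4 : (figNetwork M ε tf' tf).τ e4 = ε := rfl
  have t5 : (figNetwork M ε tf' tf).τ e5 = 2 - ε := rfl
  have t6 : (figNetwork M ε tf' tf).τ e6 = 4 := rfl
  have t7 : (figNetwork M ε tf' tf).τ e7 = 1 := rfl
  rw [t1] at f1
  rw [t2] at f2
  rw [t3] at f3
  rw [t4] at f4
  rw [t5] at f5
  rw [t6] at f6
  rw [t7] at f7
  have p3 := mul_le_mul_of_nonneg_left g3 hε.le
  have p4 := mul_le_mul_of_nonneg_left g4 hε.le
  have p5 := mul_le_mul_of_nonneg_left g5 (by linarith : 0 ≤ 2 - ε)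
  -- With `K` the iterated bound, the delays cost at least `l * (13 + M - K) + (1 - l) * (10 + M -
  -- K)`, which is at least `10 + M - K`.
  have q3 := mul_le_mul_of_nonneg_left w3 (le_max_left 0 (1 - l))
  have q4 := mul_le_mul_of_nonneg_left w4 (by linarith : 0 ≤ l / 2)
  have r3 : (1 - l) * (10 + M - (exitBound^[4] 5 : ℕ)) ≤
      max 0 (1 - l) * (10 + M - (exitBound^[4] 5 : ℕ)) :=
    mul_le_mul_of_nonneg_right (le_max_right _ _) (by linarith)
  unfold VickreyNetwork.pairing
  rw [FigEdge.sum_univ]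
  linarith

end IsDirect

end LowerBound

end FigNet

/-! ### Implementable flows are direct. -/

theorem VickreyNetwork.walkCost_cons {E : Type} (D c : E → ℝ → ℝ) (e : E) (l : List E) (t : ℝ) :
    walkCost D c (e :: l) t = c e t + walkCost D c l (t + D e t) := by
  unfold walkCost
  exact Fin.sum_univ_succ (n := l.length) fun j : Fin (e :: l).length =>
    c ((e :: l).get j) (arrival D (e :: l) j t)

namespace FigNet

section Equilibrium

variable {M ε tf' tf : ℝ} {g D p : FigEdge → ℝ → ℝ}
  {h : (figNetwork M ε tf' tf).CWalk → ℝ → ℝ}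

/-- With nonnegative tolls, the first commodity avoids the cycle in equilibrium. -/
theorem ae_eq_zero_of_isEquilibrium (hε : 0 < ε) (hε1 : ε ≤ 1) (htf : tf' ≤ tf)
    (hK : ((exitBound^[4] 5 : ℕ) : ℝ) ≤ tf') (hI : (figNetwork M ε tf' tf).Induces h g D)
    (hp : ∀ e, ∀ t ∈ (figNetwork M ε tf' tf).H, 0 ≤ p e t)
    (heq : (figNetwork M ε tf' tf).IsEquilibrium h D p)
    (w : (figNetwork M ε tf' tf).Walk c1) (hw : w.1 ≠ [e7]) :
    ∀ᵐ s ∂(volume.restrict (figNetwork M ε tf' tf).H), h ⟨c1, w⟩ s = 0 := by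
  obtain hw' | ⟨l, hl⟩ := walk_c1 w.2
  · exact absurd hw' hw
  filter_upwards [heq c1 w, ae_mem_Ioo hI (a := 0) (b := 1) rfl w, (hI.isRate_walk ⟨c1, w⟩).2,
    ae_restrict_mem measurableSet_H] with s hs hsupp hnn hsH
  by_contra hne
  have hs01 := hsupp hne
  have hle := hs (lt_of_le_of_ne hnn (Ne.symm hne)) ⟨[e7], rfl, rfl⟩
  have harr : ∀ j, j ≤ l.length →
      arrival D l j (s + D e7 s + D e5 (s + D e7 s)) ∈ (figNetwork M ε tf' tf).H := by
    intro j hj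
    have := hI.traversal.mapsTo c1 w (j + 2) (by simp [hl, hj]) hsH
    rw [hl] at this
    exact this
  have harr1 : s + D e7 s ∈ (figNetwork M ε tf' tf).H := by
    have := hI.traversal.mapsTo c1 w 1 (by simp [hl]) hsH
    rw [hl] at this
    exact this
  -- Applied to travel times and to tolls: the rest of the walk never has negative cost, so it is
  -- enough to see that `e5` takes positive time.
  have hcost : ∀ c : FigEdge → ℝ → ℝ, (∀ e, ∀ t ∈ (figNetwork M ε tf' tf).H, 0 ≤ c e t) →
      c e7 s + c e5 (s + D e7 s) ≤ walkCost D c w.1 s := by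
    intro c hc
    rw [hl, walkCost_cons, walkCost_cons]
    have : 0 ≤ walkCost D c l (s + D e7 s + D e5 (s + D e7 s)) :=
      Finset.sum_nonneg fun j _ => hc _ _ (harr j j.2.le)
    linarith
  have h1 := hcost D hI.traversal.nonneg
  have h2 := hcost p hp
  have h3 : ∀ c : FigEdge → ℝ → ℝ, walkCost D c [e7] s = c e7 s := by
    intro c
    rw [walkCost_cons]
    simp [walkCost]
  -- The lower bound `2 - ε` on the time of `e5` is available only inside the planning horizon.
  have h4 : s + D e7 s ≤ tf' := by
    have h5 := exit_le_exitBound hε hε1 htf hI e7 (n := 5)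
      (((exitBound_iterate_mono (j := 0) (by norm_num)).trans hK)) hs01.1.le
      (by norm_num; linarith [hs01.2])
    exact h5.trans ((exitBound_iterate_mono (j := 1) (by norm_num)).trans hK)
  have h5 := hI.traversal.τ_le htf e5 (t := s + D e7 s) ⟨harr1.1, h4⟩
  have h6 : (figNetwork M ε tf' tf).τ e5 = 2 - ε := rfl
  have h7 := hp e5 _ harr1
  have h8 : (figNetwork M ε tf' tf).vot c1 = 1 := rfl
  rw [h8, one_mul, one_mul] at hle
  change walkCost D D w.1 s + walkCost D p w.1 s ≤
    walkCost D D [e7] s + walkCost D p [e7] s at hle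
  rw [h3, h3] at hle
  linarith

end Equilibrium

end FigNet

/-! ### Verifying explicit Vickrey traversal times. -/

namespace VickreyNetwork

section Criterion

variable {V E I : Type} {N : VickreyNetwork V E I} {e : E} {f d : ℝ → ℝ}

theorem setIntegral_Icc_of_eq_zero {a b : ℝ} (hf : ∀ t, t < 0 → f t = 0) (ha : a ≤ 0) :
    ∫ s in Icc a b, f s = ∫ s in Icc 0 b, f s := by
  refine setIntegral_eq_of_subset_of_forall_sdiff_eq_zero measurableSet_Icc
    (Icc_subset_Icc_left ha) fun s hs => hf s ?_
  by_contra! hcon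
  exact hs.2 ⟨hcon, hs.1.2⟩

/-- The cumulative outflow if the exit times have the generalized inverse `σ`. -/
theorem cumOutflow_eq_of_inverse {t x : ℝ} (hf : ∀ s, N.tf < s → f s = 0)
    (hd : ∀ s ∈ N.H, 0 ≤ d s) (hx : ∀ s, s + d s ≤ t ↔ s ≤ x) :
    N.cumOutflow f d t = ∫ s in Icc 0 x, f s := by
  have hset : {s ∈ N.H | s + d s ∈ Icc 0 t} = Icc 0 (min x N.tf) := by
    ext s
    constructor
    · rintro ⟨⟨h0, h1⟩, -, h2⟩
      exact ⟨h0, le_min ((hx s).1 h2) h1⟩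
    · rintro ⟨h0, h1⟩
      have hsH : s ∈ N.H := ⟨h0, h1.trans (min_le_right _ _)⟩
      exact ⟨hsH, add_nonneg h0 (hd s hsH), (hx s).2 (h1.trans (min_le_left _ _))⟩
  unfold cumOutflow
  rw [hset]
  symm
  refine setIntegral_eq_of_subset_of_forall_sdiff_eq_zero measurableSet_Icc
    (Icc_subset_Icc_right (min_le_left _ _)) fun s hs => hf s ?_
  by_contra! hcon
  exact hs.2 ⟨hs.1.1, le_min hs.1.2 hcon⟩

/-- If the inflow never exceeds the service rate, the traversal times are the free flow ones. -/
theorem isVickreyTime_const (hτ : 0 ≤ N.τ e) (hint : Integrable f) (hf : ∀ t, 0 ≤ f t)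
    (hf0 : ∀ t, t < 0 → f t = 0) (hf1 : ∀ s, N.tf < s → f s = 0)
    (hν : ∀ t, ENNReal.ofReal (f t) ≤ N.ν e) : N.IsVickreyTime e f fun _ => N.τ e := by
  have hF : ∀ t, N.cumOutflow f (fun _ => N.τ e) t = ∫ s in Icc 0 (t - N.τ e), f s :=
    fun t => cumOutflow_eq_of_inverse hf1 (fun _ _ => hτ) fun s => le_sub_iff_add_le.symm
  have hq : ∀ t, N.queue e f (fun _ => N.τ e) t = 0 := by
    intro t
    unfold queue
    rw [hF]
    simp
  refine ⟨fun t _ => by simp [hq], fun t _ => (hq t).ge, fun t => f (t - N.τ e),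
    fun t => (hint.comp_sub_right _).integrableOn,
    Filter.Eventually.of_forall fun t => ⟨hf _, hν _⟩, fun t ht => ?_⟩
  rw [hF, ← setIntegral_Icc_of_eq_zero hf0 (a := 0 - N.τ e) (by linarith),
    ← integral_indicator measurableSet_Icc, ← integral_indicator measurableSet_Icc,
    ← integral_sub_right_eq_self _ (N.τ e)]
  congr 1
  ext s
  simp [indicator]

end Criterion

theorem mapsTo_arrival {V E I : Type} {N : VickreyNetwork V E I} {D : E → ℝ → ℝ}
    (hD : ∀ e, MapsTo (fun t => t + D e t) N.H N.H) (w : List E) (j : ℕ) :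
    MapsTo (arrival D w j) N.H N.H := by
  unfold arrival
  induction w.take j with
  | nil => exact fun _ h => h
  | cons e l ih => exact fun t ht => ih (hD e ht)

end VickreyNetwork

/-! ### The good flow: edge flow, waiting times and Vickrey conditions. -/

namespace FigNet

section Construction

variable {M ε tf' tf : ℝ}

/-- The walks used by the good flow: only the first commodity runs through the cycle. -/
def optWalk (M ε tf' tf : ℝ) : ∀ i, (figNetwork M ε tf' tf).Walk i
  | .c1 => ⟨[e7, e5, e4, e6], rfl, rfl, rfl, rfl, rfl⟩
  | .c2 => walkC2
  | .c3 => ⟨[e3], rfl, rfl⟩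
  | .c4 => walkC4
  | .c5 => ⟨[e4], rfl, rfl⟩

open Classical in
/-- The walk flow along `optWalk`. -/
noncomputable def optWalkFlow (w : (figNetwork M ε tf' tf).CWalk) (t : ℝ) : ℝ :=
  if w.2 = optWalk M ε tf' tf w.1 then (figNetwork M ε tf' tf).inflow w.1 t else 0

/-- The edge flow induced by `optWalkFlow`. -/
noncomputable def optFlow (M ε : ℝ) : FigEdge → ℝ → ℝ
  | .e1 => (Icc 4 5).indicator fun _ => 1
  | .e2 => fun t => (Icc 5 6).indicator (fun _ => 1) t + (Icc 6 7).indicator (fun _ => 2) t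
  | .e3 => (Icc 6 (10 + M)).indicator fun _ => 1
  | .e4 => fun t => (Icc (3 - ε) (7 - ε)).indicator (fun _ => 2) t +
      (Icc 9 (13 + M)).indicator (fun _ => 2) t
  | .e5 => fun t => (Icc 1 2).indicator (fun _ => 6) t + (Icc 2 3).indicator (fun _ => 2) t
  | .e6 => (Icc 3 6).indicator fun _ => 2
  | .e7 => (Icc 0 1).indicator fun _ => 6

/-- The waiting times in the queues under `optFlow`. -/
noncomputable def optWait : FigEdge → ℝ → ℝ
  | .e2 => fun t => max 0 (min (t - 6) (8 - t))
  | .e5 => fun t => max 0 (min (2 * (t - 1)) (min 2 (5 - t)))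
  | _ => fun _ => 0

/-- The traversal times under `optFlow`, cut off at the end of the horizon. -/
noncomputable def optTime (M ε tf' tf : ℝ) (e : FigEdge) (t : ℝ) : ℝ :=
  min ((figNetwork M ε tf' tf).τ e + optWait e t) (tf - t)

theorem integrable_indicator_Icc (a b c : ℝ) :
    Integrable ((Icc a b).indicator fun _ => c) :=
  (integrable_indicator_iff measurableSet_Icc).2 (by simp)

theorem integrable_optFlow (e : FigEdge) : Integrable (optFlow M ε e) := by
  cases e <;> first
    | exact integrable_indicator_Icc _ _ _
    | exact (integrable_indicator_Icc _ _ _).add (integrable_indicator_Icc _ _ _)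

theorem optFlow_nonneg (e : FigEdge) (t : ℝ) : 0 ≤ optFlow M ε e t := by
  cases e <;> simp only [optFlow, indicator] <;> split_ifs <;> norm_num

theorem optFlow_eq_zero (hM : 0 ≤ M) (hε : 0 < ε) (hε1 : ε ≤ 1) (e : FigEdge) {t : ℝ}
    (ht : t < 0 ∨ 13 + M < t) : optFlow M ε e t = 0 := by
  have key : ∀ a b c : ℝ, 0 ≤ a → b ≤ 13 + M → (Icc a b).indicator (fun _ => c) t = 0 := by
    intro a b c ha hb
    refine indicator_of_notMem (fun h => ?_) _
    rcases ht with ht | ht <;> linarith [h.1, h.2]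
  cases e <;> simp only [optFlow] <;>
    first
    | exact key _ _ _ (by linarith) (by linarith)
    | rw [key _ _ _ (by linarith) (by linarith), key _ _ _ (by linarith) (by linarith), add_zero]

theorem setIntegral_optFlow (hε1 : ε ≤ 1) (e : FigEdge) (t : ℝ) :
    ∫ s in Icc 0 t, optFlow M ε e s = match e with
      | .e1 => max 0 (min t 5 - 4)
      | .e2 => max 0 (min t 6 - 5) + 2 * max 0 (min t 7 - 6)
      | .e3 => max 0 (min t (10 + M) - 6)
      | .e4 => 2 * max 0 (min t (7 - ε) - (3 - ε)) + 2 * max 0 (min t (13 + M) - 9)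
      | .e5 => 6 * max 0 (min t 2 - 1) + 2 * max 0 (min t 3 - 2)
      | .e6 => 2 * max 0 (min t 6 - 3)
      | .e7 => 6 * max 0 (min t 1 - 0) := by
  cases e <;> simp only [optFlow] <;> first
    | rw [setIntegral_Icc_indicator _ _ (by linarith)]
    | rw [integral_add (integrable_indicator_Icc _ _ _).integrableOn
        (integrable_indicator_Icc _ _ _).integrableOn, setIntegral_Icc_indicator _ _ (by linarith),
        setIntegral_Icc_indicator _ _ (by linarith)]
  all_goals simp only [one_mul]

theorem optWait_nonneg (e : FigEdge) (t : ℝ) : 0 ≤ optWait e t := by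
  cases e <;> first | exact le_rfl | exact le_max_left _ _

theorem optWait_le (e : FigEdge) (t : ℝ) : optWait e t ≤ 2 := by
  cases e <;> simp only [optWait] <;> norm_num
  by_cases h : t ≤ 7
  · left; linarith
  · right; linarith

theorem isVickreyTime_e2 (hM : 0 ≤ M) (htf : 13 + M ≤ tf) (hε : 0 < ε) (hε1 : ε ≤ 1) :
    (figNetwork M ε tf' tf).IsVickreyTime e2 (optFlow M ε e2) fun t => 1 + optWait e2 t := by
  -- The generalized inverse of the exit time, which is `2 * t - 5` on `[6, 7]`, constantly 9 on
  -- `[7, 8]` and `t + 1` elsewhere.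
  obtain ⟨σ, hσ⟩ : ∃ σ : ℝ → ℝ, σ = fun t =>
    if t < 7 then t - 1 else if t < 9 then (t + 5) / 2 else t - 1 := ⟨_, rfl⟩
  have hinv : ∀ t s, s + (1 + optWait e2 s) ≤ t ↔ s ≤ σ t := by
    intro t s
    simp only [hσ, optWait]
    grind
  have hF : ∀ t, (figNetwork M ε tf' tf).cumOutflow (optFlow M ε e2)
      (fun t => 1 + optWait e2 t) t = max 0 (min t 9 - 6) := by
    intro t
    rw [cumOutflow_eq_of_inverse (x := σ t) (fun s hs => optFlow_eq_zero hM hε hε1 e2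
      (Or.inr (htf.trans_lt hs))) (fun s _ => by linarith [optWait_nonneg e2 s]) (hinv t),
      setIntegral_optFlow hε1]
    simp only [hσ]
    grind
  have hq : ∀ t, (figNetwork M ε tf' tf).queue e2 (optFlow M ε e2)
      (fun t => 1 + optWait e2 t) t = optWait e2 t := by
    intro t
    unfold queue
    rw [hF, setIntegral_optFlow hε1]
    simp only [figNetwork, optWait]
    grind
  refine ⟨fun t _ => ?_, fun t _ => ?_, (Icc 6 9).indicator fun _ => 1,
    fun t => (integrable_indicator_Icc _ _ _).integrableOn,
    Filter.Eventually.of_forall fun t => ⟨?_, ?_⟩, fun t _ => ?_⟩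
  · rw [hq]
    simp [figNetwork]
  · rw [hq]
    exact optWait_nonneg _ _
  · simp only [indicator]
    split_ifs <;> norm_num
  · simp only [figNetwork, indicator]
    split_ifs <;> simp
  · rw [hF, setIntegral_Icc_indicator _ _ (by norm_num), one_mul]

theorem isVickreyTime_e5 (hM : 0 ≤ M) (htf : 13 + M ≤ tf) (hε : 0 < ε) (hε1 : ε ≤ 1) :
    (figNetwork M ε tf' tf).IsVickreyTime e5 (optFlow M ε e5)
      fun t => 2 - ε + optWait e5 t := by
  -- The inverse of the exit time, which is `3 * t - ε` while the queue builds up on `[1, 2]`, `t +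
  -- 4 - ε` on `[2, 3]`, constantly `7 - ε` on `[3, 5]` and `t + 2 - ε` elsewhere.
  obtain ⟨σ, hσ⟩ : ∃ σ : ℝ → ℝ, σ = fun t =>
    if t < 3 - ε then t - 2 + ε else if t < 6 - ε then (t + ε) / 3 else
      if t < 7 - ε then t - 4 + ε else t - 2 + ε := ⟨_, rfl⟩
  have hinv : ∀ t s, s + (2 - ε + optWait e5 s) ≤ t ↔ s ≤ σ t := by
    intro t s
    simp only [hσ, optWait]
    grind
  have hF : ∀ t, (figNetwork M ε tf' tf).cumOutflow (optFlow M ε e5)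
      (fun t => 2 - ε + optWait e5 t) t = 2 * max 0 (min t (7 - ε) - (3 - ε)) := by
    intro t
    rw [cumOutflow_eq_of_inverse (x := σ t) (fun s hs => optFlow_eq_zero hM hε hε1 e5
      (Or.inr (htf.trans_lt hs))) (fun s _ => by linarith [optWait_nonneg e5 s]) (hinv t),
      setIntegral_optFlow hε1]
    simp only [hσ]
    grind
  have hq : ∀ t, (figNetwork M ε tf' tf).queue e5 (optFlow M ε e5)
      (fun t => 2 - ε + optWait e5 t) t = 2 * optWait e5 t := by
    intro t
    unfold queue
    rw [hF, setIntegral_optFlow hε1]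
    simp only [figNetwork, optWait]
    grind
  refine ⟨fun t _ => ?_, fun t _ => ?_, (Icc (3 - ε) (7 - ε)).indicator fun _ => 2,
    fun t => (integrable_indicator_Icc _ _ _).integrableOn,
    Filter.Eventually.of_forall fun t => ⟨?_, ?_⟩, fun t _ => ?_⟩
  · rw [hq]
    simp only [figNetwork, ENNReal.toReal_inv, ENNReal.toReal_ofNat]
    ring
  · rw [hq]
    linarith [optWait_nonneg e5 t]
  · simp only [indicator]
    split_ifs <;> norm_num
  · simp only [figNetwork, indicator]
    split_ifs <;> simp
  · rw [hF, setIntegral_Icc_indicator _ _ (by linarith)]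

theorem isVickreyTime_optFlow (hM : 0 ≤ M) (htf : 13 + M ≤ tf) (hε : 0 < ε) (hε1 : ε ≤ 1)
    (e : FigEdge) :
    (figNetwork M ε tf' tf).IsVickreyTime e (optFlow M ε e)
      fun t => (figNetwork M ε tf' tf).τ e + optWait e t := by
  have key : optWait e = (fun _ => 0) →
      (∀ t, ENNReal.ofReal (optFlow M ε e t) ≤ (figNetwork M ε tf' tf).ν e) →
      (figNetwork M ε tf' tf).IsVickreyTime e (optFlow M ε e)
        fun t => (figNetwork M ε tf' tf).τ e + optWait e t := by
    intro h1 h2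
    rw [h1]
    simp only [add_zero]
    exact isVickreyTime_const (τ_nonneg hε hε1 e) (integrable_optFlow e) (optFlow_nonneg e)
      (fun t ht => optFlow_eq_zero hM hε hε1 e (Or.inl ht))
      (fun t ht => optFlow_eq_zero hM hε hε1 e (Or.inr (htf.trans_lt ht))) h2
  have hle : ∀ c : ℝ, (∀ t, optFlow M ε e t ≤ c) →
      (figNetwork M ε tf' tf).ν e = ENNReal.ofReal c →
      ∀ t, ENNReal.ofReal (optFlow M ε e t) ≤ (figNetwork M ε tf' tf).ν e := by
    intro c hc hν t
    rw [hν]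
    exact ENNReal.ofReal_le_ofReal (hc t)
  cases e with
  | e2 => exact isVickreyTime_e2 hM htf hε hε1
  | e5 => exact isVickreyTime_e5 hM htf hε hε1
  | e6 => exact key rfl fun t => le_top
  | e1 =>
    refine key rfl (hle 1 (fun t => ?_) (by simp [figNetwork]))
    simp only [optFlow, indicator]
    split_ifs <;> norm_num
  | e3 =>
    refine key rfl (hle 1 (fun t => ?_) (by simp [figNetwork]))
    simp only [optFlow, indicator]
    split_ifs <;> norm_num
  | e4 =>
    refine key rfl (hle 2 (fun t => ?_) (by simp [figNetwork]))
    simp only [optFlow, indicator]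
    split_ifs with h1 h2
    · linarith [h1.2, h2.1]
    all_goals norm_num
  | e7 =>
    refine key rfl (hle 6 (fun t => ?_) (by simp [figNetwork]))
    simp only [optFlow, indicator]
    split_ifs <;> norm_num

end Construction

end FigNet

/-! ### Loading the good flow: arrivals, induced edge flow and cost. -/

namespace VickreyNetwork

section

variable {V E I : Type} {N : VickreyNetwork V E I} {D : E → ℝ → ℝ} {f : ℝ → ℝ}

open Classical in
theorem edgeMass_singleton (x e : E) (t : ℝ) :
    N.edgeMass D f [x] e t = if x = e then N.arrivedMass D f [x] 0 t else 0 := by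
  unfold edgeMass
  exact Fin.sum_univ_one _

open Classical in
theorem edgeMass_three (x y z e : E) (t : ℝ) :
    N.edgeMass D f [x, y, z] e t = (if x = e then N.arrivedMass D f [x, y, z] 0 t else 0) +
      (if y = e then N.arrivedMass D f [x, y, z] 1 t else 0) +
      (if z = e then N.arrivedMass D f [x, y, z] 2 t else 0) := by
  unfold edgeMass
  exact Fin.sum_univ_three _

open Classical in
theorem edgeMass_four (x y z u e : E) (t : ℝ) :
    N.edgeMass D f [x, y, z, u] e t =
      (if x = e then N.arrivedMass D f [x, y, z, u] 0 t else 0) +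
      (if y = e then N.arrivedMass D f [x, y, z, u] 1 t else 0) +
      (if z = e then N.arrivedMass D f [x, y, z, u] 2 t else 0) +
      (if u = e then N.arrivedMass D f [x, y, z, u] 3 t else 0) := by
  unfold edgeMass
  exact Fin.sum_univ_four _

/-- The arrivals of a constant inflow under an affine arrival time function. -/
theorem arrivedMass_affine {w : List E} {j : ℕ} {a b c α β : ℝ} (ha : 0 ≤ a) (hb : b ≤ N.tf)
    (hα : 0 < α) (h0 : 0 ≤ α * a + β)
    (harr : ∀ s ∈ Icc a b, arrival D w j s = α * s + β) (t : ℝ) :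
    N.arrivedMass D ((Icc a b).indicator fun _ => c) w j t =
      c / α * max 0 (min t (α * b + β) - (α * a + β)) := by
  have hset : {s ∈ N.H | arrival D w j s ∈ Icc 0 t} ∩ Icc a b =
      Icc a (min ((t - β) / α) b) := by
    ext s
    constructor
    · rintro ⟨⟨-, hs⟩, hsab⟩
      rw [harr s hsab] at hs
      refine ⟨hsab.1, le_min ?_ hsab.2⟩
      rw [le_div_iff₀ hα]
      linarith [hs.2]
    · rintro ⟨hs1, hs2⟩
      have hsb : s ≤ b := hs2.trans (min_le_right _ _)
      have hst := hs2.trans (min_le_left _ _)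
      rw [le_div_iff₀ hα] at hst
      refine ⟨⟨⟨ha.trans hs1, hsb.trans hb⟩, ?_⟩, hs1, hsb⟩
      rw [harr s ⟨hs1, hsb⟩]
      have := mul_le_mul_of_nonneg_left hs1 hα.le
      exact ⟨by linarith, by linarith⟩
  have hmin : min t (α * b + β) - (α * a + β) = α * (min ((t - β) / α) b - a) := by
    rw [mul_sub, mul_min_of_nonneg _ _ hα.le, mul_div_cancel₀ _ hα.ne', ← min_sub_sub_right,
      ← min_sub_sub_right]
    congr 1 <;> ring
  unfold arrivedMass
  rw [setIntegral_indicator measurableSet_Icc, hset, hmin]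
  have hmax : max 0 (α * (min ((t - β) / α) b - a)) = α * max 0 (min ((t - β) / α) b - a) := by
    rw [mul_max_of_nonneg _ _ hα.le, mul_zero]
  rw [hmax, ← mul_assoc, div_mul_cancel₀ _ hα.ne']
  simp [mul_comm, max_comm]

end

end VickreyNetwork

namespace FigNet

section Construction

variable {M ε tf' tf : ℝ}

theorem τ_add_optWait_nonneg (hε : 0 < ε) (hε1 : ε ≤ 1) (e : FigEdge) (t : ℝ) :
    0 ≤ (figNetwork M ε tf' tf).τ e + optWait e t :=
  add_nonneg (τ_nonneg hε hε1 e) (optWait_nonneg e t)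

theorem optTime_eq (hM : 0 ≤ M) (hε : 0 < ε) (hε1 : ε ≤ 1) (htf : tf' + (24 + 3 * M) ≤ tf)
    (e : FigEdge) {t : ℝ} (ht : t ≤ tf') :
    optTime M ε tf' tf e t = (figNetwork M ε tf' tf).τ e + optWait e t := by
  refine min_eq_left ?_
  linarith [optWait_le e t, τ_le_four (M := M) (tf' := tf') (tf := tf) hε hε1 e]

theorem add_optTime (e : FigEdge) (t : ℝ) :
    t + optTime M ε tf' tf e t = min (t + ((figNetwork M ε tf' tf).τ e + optWait e t)) tf := by
  unfold optTime
  rw [← min_add_add_left]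
  congr 1
  ring

theorem monotone_add_optWait (e : FigEdge) : Monotone fun t => t + optWait e t := by
  intro s t hst
  cases e <;> simp only [optWait] <;> grind

theorem lipschitzWith_mul_add (a b : ℝ) : LipschitzWith ‖a‖₊ fun t : ℝ => a * t + b :=
  LipschitzWith.of_dist_le_mul fun x y => by
    simp [Real.dist_eq, ← mul_sub, abs_mul]

theorem exists_lipschitzWith_optTime (e : FigEdge) :
    ∃ K, LipschitzWith K (optTime M ε tf' tf e) := by
  have h1 : ∃ K, LipschitzWith K fun t => (figNetwork M ε tf' tf).τ e + optWait e t := by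
    have h2 : ∃ K, LipschitzWith K (optWait e) := by
      cases e with
      | e2 =>
        have hfun : optWait e2 = fun t => max (min (1 * t + -6) (-1 * t + 8)) 0 := by
          funext t
          simp only [optWait]
          grind
        rw [hfun]
        exact ⟨_, ((lipschitzWith_mul_add 1 (-6)).min (lipschitzWith_mul_add (-1) 8)).max_const 0⟩
      | e5 =>
        have hfun : optWait e5 = fun t => max (min (2 * t + -2) (min 2 (-1 * t + 5))) 0 := by
          funext t
          simp only [optWait]
          grind
        rw [hfun]
        exact ⟨_, ((lipschitzWith_mul_add 2 (-2)).min ((LipschitzWith.const 2).min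
          (lipschitzWith_mul_add (-1) 5))).max_const 0⟩
      | _ => exact ⟨0, LipschitzWith.const 0⟩
    obtain ⟨K, hK⟩ := h2
    exact ⟨_, (LipschitzWith.const _).add hK⟩
  obtain ⟨K, hK⟩ := h1
  have h3 : LipschitzWith 1 fun t : ℝ => tf - t := by
    simpa [sub_eq_add_neg, add_comm] using lipschitzWith_mul_add (-1) tf
  exact ⟨_, hK.min h3⟩

theorem isTraversalTime_optTime (hM : 0 ≤ M) (hε : 0 < ε) (hε1 : ε ≤ 1) (h13 : 13 + M ≤ tf')
    (htf : tf' + (24 + 3 * M) ≤ tf) :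
    (figNetwork M ε tf' tf).IsTraversalTime (optFlow M ε) (optTime M ε tf' tf) := by
  have hfifo : ∀ e, Monotone fun t => t + optTime M ε tf' tf e t := by
    intro e s t hst
    simp only [add_optTime]
    have := monotone_add_optWait e hst
    refine min_le_min_right _ ?_
    simp only at this
    linarith
  refine ⟨fun e => ⟨_, isVickreyTime_optFlow hM (by linarith) hε hε1 e,
    fun t ht => optTime_eq hM hε hε1 htf e ht.2⟩, fun e t ht => ?_, fun e => ?_,
    fun e => (hfifo e).monotoneOn _, fun i w j _ => mapsTo_arrival (fun e t ht => ?_) w.1 j⟩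
  · exact le_min (τ_add_optWait_nonneg hε hε1 e t) (sub_nonneg.2 ht.2)
  · obtain ⟨K, hK⟩ := exists_lipschitzWith_optTime (M := M) (ε := ε) (tf' := tf') (tf := tf) e
    exact (hK.lipschitzOnWith (s := uIcc 0 tf)).absolutelyContinuousOnInterval
  · simp only [add_optTime]
    exact ⟨le_min (add_nonneg ht.1 (τ_add_optWait_nonneg hε hε1 e t)) (ht.1.trans ht.2),
      min_le_right _ _⟩

end Construction

end FigNet

namespace FigNet

section Construction

variable {M ε tf' tf : ℝ}

/-- The bottleneck `e5` stretches the inflow of rate 6 during `[1, 2]` to rate 2 during `[3 - ε, 6 -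
ε]`, so that `e4` has no queue. -/
theorem edgeMass_optWalk_c1 (hM : 0 ≤ M) (hε : 0 < ε) (hε1 : ε ≤ 1) (h13 : 13 + M ≤ tf')
    (htf : tf' + (24 + 3 * M) ≤ tf) (e : FigEdge) (t : ℝ) :
    (figNetwork M ε tf' tf).edgeMass (optTime M ε tf' tf) ((figNetwork M ε tf' tf).inflow c1)
      (optWalk M ε tf' tf c1).1 e t = match e with
      | .e4 => 2 * max 0 (min t (6 - ε) - (3 - ε))
      | .e5 => 6 * max 0 (min t 2 - 1)
      | .e6 => 2 * max 0 (min t 6 - 3)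
      | .e7 => 6 * max 0 (min t 1 - 0)
      | _ => 0 := by
  have hr : (figNetwork M ε tf' tf).inflow c1 = (Icc 0 1).indicator fun _ => 6 := rfl
  have ha1 : ∀ s ∈ Icc (0 : ℝ) 1,
      arrival (optTime M ε tf' tf) [e7, e5, e4, e6] 1 s = 1 * s + 1 := by
    intro s hs
    change s + optTime M ε tf' tf e7 s = 1 * s + 1
    rw [optTime_eq hM hε hε1 htf e7 (by linarith [hs.2])]
    simp [figNetwork, optWait]
  have ha2 : ∀ s ∈ Icc (0 : ℝ) 1,
      arrival (optTime M ε tf' tf) [e7, e5, e4, e6] 2 s = 3 * s + (3 - ε) := by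
    intro s hs
    rw [arrival_succ _ _ (by simp), ha1 s hs]
    change 1 * s + 1 + optTime M ε tf' tf e5 (1 * s + 1) = 3 * s + (3 - ε)
    rw [optTime_eq hM hε hε1 htf e5 (by linarith [hs.2])]
    obtain ⟨hs0, hs1⟩ := hs
    simp only [figNetwork, optWait]
    grind
  have ha3 : ∀ s ∈ Icc (0 : ℝ) 1,
      arrival (optTime M ε tf' tf) [e7, e5, e4, e6] 3 s = 3 * s + 3 := by
    intro s hs
    rw [arrival_succ _ _ (by simp), ha2 s hs]
    change 3 * s + (3 - ε) + optTime M ε tf' tf e4 (3 * s + (3 - ε)) = 3 * s + 3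
    rw [optTime_eq hM hε hε1 htf e4 (by linarith [hs.2])]
    simp only [figNetwork, optWait]
    ring
  have htf1 : (1 : ℝ) ≤ (figNetwork M ε tf' tf).tf := by
    change 1 ≤ tf
    linarith
  change (figNetwork M ε tf' tf).edgeMass _ _ [e7, e5, e4, e6] e t = _
  rw [edgeMass_four, hr,
    arrivedMass_affine (α := 1) (β := 0) (j := 0) le_rfl htf1 (by norm_num) (by norm_num)
      (fun s _ => by simp [arrival, exitTime]),
    arrivedMass_affine (j := 1) le_rfl htf1 (by norm_num) (by norm_num) ha1,
    arrivedMass_affine (j := 2) le_rfl htf1 (by norm_num) (by linarith) ha2,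
    arrivedMass_affine (j := 3) le_rfl htf1 (by norm_num) (by norm_num) ha3]
  cases e <;> simp <;> grind

/-- The queue left by commodity 1 delays every particle by exactly 2, so `e2` is reached during `[6,
7]`. -/
theorem edgeMass_optWalk_c2 (hM : 0 ≤ M) (hε : 0 < ε) (hε1 : ε ≤ 1) (h13 : 13 + M ≤ tf')
    (htf : tf' + (24 + 3 * M) ≤ tf) (e : FigEdge) (t : ℝ) :
    (figNetwork M ε tf' tf).edgeMass (optTime M ε tf' tf) ((figNetwork M ε tf' tf).inflow c2)
      (optWalk M ε tf' tf c2).1 e t = match e with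
      | .e2 => 2 * max 0 (min t 7 - 6)
      | .e4 => 2 * max 0 (min t (7 - ε) - (6 - ε))
      | .e5 => 2 * max 0 (min t 3 - 2)
      | _ => 0 := by
  have hr : (figNetwork M ε tf' tf).inflow c2 = (Icc 2 3).indicator fun _ => 2 := rfl
  have ha1 : ∀ s ∈ Icc (2 : ℝ) 3,
      arrival (optTime M ε tf' tf) [e5, e4, e2] 1 s = 1 * s + (4 - ε) := by
    intro s hs
    change s + optTime M ε tf' tf e5 s = 1 * s + (4 - ε)
    rw [optTime_eq hM hε hε1 htf e5 (by linarith [hs.2])]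
    obtain ⟨hs0, hs1⟩ := hs
    simp only [figNetwork, optWait]
    grind
  have ha2 : ∀ s ∈ Icc (2 : ℝ) 3,
      arrival (optTime M ε tf' tf) [e5, e4, e2] 2 s = 1 * s + 4 := by
    intro s hs
    rw [arrival_succ _ _ (by simp), ha1 s hs]
    change 1 * s + (4 - ε) + optTime M ε tf' tf e4 (1 * s + (4 - ε)) = 1 * s + 4
    rw [optTime_eq hM hε hε1 htf e4 (by linarith [hs.2])]
    simp only [figNetwork, optWait]
    ring
  have htf1 : (3 : ℝ) ≤ (figNetwork M ε tf' tf).tf := by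
    change 3 ≤ tf
    linarith
  change (figNetwork M ε tf' tf).edgeMass _ _ [e5, e4, e2] e t = _
  rw [edgeMass_three, hr,
    arrivedMass_affine (α := 1) (β := 0) (j := 0) (by norm_num) htf1 (by norm_num) (by norm_num)
      (fun s _ => by simp [arrival, exitTime]),
    arrivedMass_affine (j := 1) (by norm_num) htf1 (by norm_num) (by linarith) ha1,
    arrivedMass_affine (j := 2) (by norm_num) htf1 (by norm_num) (by norm_num) ha2]
  cases e <;> simp <;> grind

/-- This commodity enters `e2` during `[5, 6]`, ahead of commodity 2, and `e3` during `[6, 7]`,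
ahead of commodity 3; it never waits. -/
theorem edgeMass_optWalk_c4 (hM : 0 ≤ M) (hε : 0 < ε) (hε1 : ε ≤ 1) (h13 : 13 + M ≤ tf')
    (htf : tf' + (24 + 3 * M) ≤ tf) (e : FigEdge) (t : ℝ) :
    (figNetwork M ε tf' tf).edgeMass (optTime M ε tf' tf) ((figNetwork M ε tf' tf).inflow c4)
      (optWalk M ε tf' tf c4).1 e t = match e with
      | .e1 => max 0 (min t 5 - 4)
      | .e2 => max 0 (min t 6 - 5)
      | .e3 => max 0 (min t 7 - 6)
      | _ => 0 := by
  have hr : (figNetwork M ε tf' tf).inflow c4 = (Icc 4 5).indicator fun _ => 1 := rfl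
  have ha1 : ∀ s ∈ Icc (4 : ℝ) 5,
      arrival (optTime M ε tf' tf) [e1, e2, e3] 1 s = 1 * s + 1 := by
    intro s hs
    change s + optTime M ε tf' tf e1 s = 1 * s + 1
    rw [optTime_eq hM hε hε1 htf e1 (by linarith [hs.2])]
    simp [figNetwork, optWait]
  have ha2 : ∀ s ∈ Icc (4 : ℝ) 5,
      arrival (optTime M ε tf' tf) [e1, e2, e3] 2 s = 1 * s + 2 := by
    intro s hs
    rw [arrival_succ _ _ (by simp), ha1 s hs]
    change 1 * s + 1 + optTime M ε tf' tf e2 (1 * s + 1) = 1 * s + 2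
    rw [optTime_eq hM hε hε1 htf e2 (by linarith [hs.2])]
    obtain ⟨hs0, hs1⟩ := hs
    simp only [figNetwork, optWait]
    grind
  have htf1 : (5 : ℝ) ≤ (figNetwork M ε tf' tf).tf := by
    change 5 ≤ tf
    linarith
  change (figNetwork M ε tf' tf).edgeMass _ _ [e1, e2, e3] e t = _
  rw [edgeMass_three, hr,
    arrivedMass_affine (α := 1) (β := 0) (j := 0) (by norm_num) htf1 (by norm_num) (by norm_num)
      (fun s _ => by simp [arrival, exitTime]),
    arrivedMass_affine (j := 1) (by norm_num) htf1 (by norm_num) (by norm_num) ha1,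
    arrivedMass_affine (j := 2) (by norm_num) htf1 (by norm_num) (by norm_num) ha2]
  cases e <;> simp <;> grind

theorem edgeMass_optWalk_c3 (hM : 0 ≤ M) (h13 : 13 + M ≤ tf')
    (htf : tf' + (24 + 3 * M) ≤ tf) (e : FigEdge) (t : ℝ) :
    (figNetwork M ε tf' tf).edgeMass (optTime M ε tf' tf) ((figNetwork M ε tf' tf).inflow c3)
      (optWalk M ε tf' tf c3).1 e t = match e with
      | .e3 => max 0 (min t (10 + M) - 7)
      | _ => 0 := by
  have hr : (figNetwork M ε tf' tf).inflow c3 = (Icc 7 (10 + M)).indicator fun _ => 1 := rfl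
  have htf1 : 10 + M ≤ (figNetwork M ε tf' tf).tf := by
    change 10 + M ≤ tf
    linarith
  change (figNetwork M ε tf' tf).edgeMass _ _ [e3] e t = _
  rw [edgeMass_singleton, hr,
    arrivedMass_affine (α := 1) (β := 0) (j := 0) (by norm_num) htf1 (by norm_num) (by norm_num)
      (fun s _ => by simp [arrival, exitTime])]
  cases e <;> simp

theorem edgeMass_optWalk_c5 (hM : 0 ≤ M) (h13 : 13 + M ≤ tf')
    (htf : tf' + (24 + 3 * M) ≤ tf) (e : FigEdge) (t : ℝ) :
    (figNetwork M ε tf' tf).edgeMass (optTime M ε tf' tf) ((figNetwork M ε tf' tf).inflow c5)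
      (optWalk M ε tf' tf c5).1 e t = match e with
      | .e4 => 2 * max 0 (min t (13 + M) - 9)
      | _ => 0 := by
  have hr : (figNetwork M ε tf' tf).inflow c5 = (Icc 9 (13 + M)).indicator fun _ => 2 := rfl
  have htf1 : 13 + M ≤ (figNetwork M ε tf' tf).tf := by
    change 13 + M ≤ tf
    linarith
  change (figNetwork M ε tf' tf).edgeMass _ _ [e4] e t = _
  rw [edgeMass_singleton, hr,
    arrivedMass_affine (α := 1) (β := 0) (j := 0) (by norm_num) htf1 (by norm_num) (by norm_num)
      (fun s _ => by simp [arrival, exitTime])]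
  cases e <;> simp

theorem optWalkFlow_self (i : FigComm) :
    (optWalkFlow ⟨i, optWalk M ε tf' tf i⟩ : ℝ → ℝ) = (figNetwork M ε tf' tf).inflow i := by
  funext t
  exact if_pos rfl

theorem optWalkFlow_of_ne {i : FigComm} {w : (figNetwork M ε tf' tf).Walk i}
    (hw : w ≠ optWalk M ε tf' tf i) : (optWalkFlow ⟨i, w⟩ : ℝ → ℝ) = fun _ => 0 := by
  funext t
  exact if_neg hw

theorem isRate_optWalkFlow (w : (figNetwork M ε tf' tf).CWalk) :
    (figNetwork M ε tf' tf).IsRate (optWalkFlow w) := by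
  obtain ⟨i, w⟩ := w
  by_cases hw : w = optWalk M ε tf' tf i
  · rw [hw, optWalkFlow_self]
    exact ⟨integrableOn_inflow i (by simp [VickreyNetwork.H]),
      Filter.Eventually.of_forall fun t => (inflow_mem i t).1⟩
  · rw [optWalkFlow_of_ne hw]
    exact ⟨integrableOn_zero, Filter.Eventually.of_forall fun t => le_rfl⟩

theorem hasSum_optWalkFlow (i : FigComm) (t : ℝ) :
    HasSum (fun w : (figNetwork M ε tf' tf).Walk i => optWalkFlow ⟨i, w⟩ t)
      ((figNetwork M ε tf' tf).inflow i t) := by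
  have h1 := hasSum_single (optWalk M ε tf' tf i)
    (f := fun w : (figNetwork M ε tf' tf).Walk i => optWalkFlow ⟨i, w⟩ t)
    (fun w hw => by rw [optWalkFlow_of_ne hw])
  rwa [optWalkFlow_self] at h1

theorem hasSum_edgeMass_optWalkFlow (D : FigEdge → ℝ → ℝ) (e : FigEdge) (t : ℝ) :
    HasSum (fun w : (figNetwork M ε tf' tf).CWalk =>
      (figNetwork M ε tf' tf).edgeMass D (optWalkFlow w) w.2.1 e t)
      (∑ i, (figNetwork M ε tf' tf).edgeMass D
        ((figNetwork M ε tf' tf).inflow i) (optWalk M ε tf' tf i).1 e t) := by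
  refine hasSum_cwalk fun i => ?_
  have h1 := hasSum_single (optWalk M ε tf' tf i) (f := fun w : (figNetwork M ε tf' tf).Walk i =>
    (figNetwork M ε tf' tf).edgeMass D (optWalkFlow ⟨i, w⟩) w.1 e t)
    (fun w hw => by
      rw [optWalkFlow_of_ne hw]
      exact edgeMass_eq_zero fun k _ _ => by simp [arrivedMass])
  rw [optWalkFlow_self] at h1
  exact h1

theorem sum_edgeMass_optWalk (hM : 0 ≤ M) (hε : 0 < ε) (hε1 : ε ≤ 1) (h13 : 13 + M ≤ tf')
    (htf : tf' + (24 + 3 * M) ≤ tf) (e : FigEdge) (t : ℝ) :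
    ∑ i, (figNetwork M ε tf' tf).edgeMass (optTime M ε tf' tf)
      ((figNetwork M ε tf' tf).inflow i) (optWalk M ε tf' tf i).1 e t =
      ∫ s in Icc 0 t, optFlow M ε e s := by
  rw [FigComm.sum_univ, setIntegral_optFlow hε1, edgeMass_optWalk_c1 hM hε hε1 h13 htf,
    edgeMass_optWalk_c2 hM hε hε1 h13 htf, edgeMass_optWalk_c3 hM h13 htf,
    edgeMass_optWalk_c4 hM hε hε1 h13 htf, edgeMass_optWalk_c5 hM h13 htf]
  cases e <;> grind

theorem induces_optFlow (hM : 0 ≤ M) (hε : 0 < ε) (hε1 : ε ≤ 1) (h13 : 13 + M ≤ tf')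
    (htf : tf' + (24 + 3 * M) ≤ tf) :
    (figNetwork M ε tf' tf).Induces optWalkFlow (optFlow M ε) (optTime M ε tf' tf) where
  isRate_walk := isRate_optWalkFlow
  sum_walk i := Filter.Eventually.of_forall (hasSum_optWalkFlow i)
  isRate_edge e := ⟨(integrable_optFlow e).integrableOn,
    Filter.Eventually.of_forall (optFlow_nonneg e)⟩
  support e := by
    filter_upwards [ae_restrict_mem measurableSet_H] with t ht ht'
    refine optFlow_eq_zero hM hε hε1 e (Or.inr ?_)
    by_contra! hcon
    exact ht' ⟨ht.1, hcon.trans h13⟩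
  traversal := isTraversalTime_optTime hM hε hε1 h13 htf
  loading e t _ := by
    rw [← sum_edgeMass_optWalk hM hε hε1 h13 htf e t]
    exact hasSum_edgeMass_optWalkFlow _ e t

/-- On each edge the traversal time is bounded by its maximum: waiting is at most 1 on `e2`, at most
2 on `e5` and zero elsewhere. In particular `M` enters only through free flow times on `e3` and
`e4`. -/
theorem pairing_optFlow_le (hM : 0 ≤ M) (hε : 0 < ε) (hε1 : ε ≤ 1) (h13 : 13 + M ≤ tf')
    (htf : tf' + (24 + 3 * M) ≤ tf) :
    (figNetwork M ε tf' tf).pairing (optTime M ε tf' tf) (optFlow M ε) ≤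
      69 - 8 * ε + ε * (4 + M) + ε * (16 + 2 * M) := by
  have hle : ∀ e, ∀ B, (∀ t, optWait e t ≤ B) →
      ∫ t in (figNetwork M ε tf' tf).H, optTime M ε tf' tf e t * optFlow M ε e t ≤
        ((figNetwork M ε tf' tf).τ e + B) * ∫ t in Icc 0 tf, optFlow M ε e t := by
    intro e B hB
    rw [← integral_const_mul]
    refine setIntegral_mono ?_ ((integrable_optFlow e).integrableOn.const_mul _) fun t => ?_
    · exact (integrable_optFlow e).integrableOn.continuousOn_mul
        ((isTraversalTime_optTime hM hε hε1 h13 htf).continuousOn e) isCompact_Icc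
    · refine mul_le_mul_of_nonneg_right ((min_le_left _ _).trans ?_) (optFlow_nonneg e t)
      linarith [hB t]
  have h0 : ∀ e, optWait e = (fun _ => 0) → ∀ t, optWait e t ≤ 0 := by
    intro e he t
    rw [he]
  have h1 := hle e1 0 (h0 e1 rfl)
  have h2 := hle e2 1 (fun t => by simp only [optWait]; grind)
  have h3 := hle e3 0 (h0 e3 rfl)
  have h4 := hle e4 0 (h0 e4 rfl)
  have h5 := hle e5 2 (optWait_le e5)
  have h6 := hle e6 0 (h0 e6 rfl)
  have h7 := hle e7 0 (h0 e7 rfl)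
  have hmin : ∀ x, x ≤ 13 + M → min tf x = x := fun x hx => min_eq_right (by linarith)
  rw [setIntegral_optFlow hε1] at h1 h2 h3 h4 h5 h6 h7
  simp only [figNetwork] at h1 h2 h3 h4 h5 h6 h7
  rw [hmin _ (by linarith), max_eq_right (by linarith)] at h1 h3 h6 h7
  rw [hmin _ (by linarith), max_eq_right (by linarith), hmin _ (by linarith),
    max_eq_right (by linarith)] at h2 h4 h5
  unfold VickreyNetwork.pairing
  rw [FigEdge.sum_univ]
  simp only [figNetwork] at *
  linarith

end Construction

end FigNet

/-! ### Comparison of the two bounds. -/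

theorem mainTheorem1 :
    ∃ M₀ : ℝ, 0 ≤ M₀ ∧ ∀ M : ℝ, M₀ ≤ M → ∀ ε : ℝ, 0 < ε → ε ≤ 1 →
      ∀ tf' tf : ℝ, 13 + M ≤ tf' → tf' + (24 + 3 * M) ≤ tf →
        ∀ g : FigEdge → ℝ → ℝ,
          (figNetwork M ε tf' tf).IsSystemOptimal g →
            ¬ (figNetwork M ε tf' tf).IsImplementable g := by
  -- The lower bound minus the upper bound is `M - K - 45` with `K` the iterated bound; all terms in
  -- `ε` cancel.
  refine ⟨(FigNet.exitBound^[4] 5 : ℕ) + 46, by positivity, ?_⟩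
  rintro M hM ε hε hε1 tf' tf h13 htf g ⟨h₀, D₀, hI₀, hopt⟩ ⟨h, D, p, hI, hp, -, heq⟩
  have hK : (0 : ℝ) ≤ (FigNet.exitBound^[4] 5 : ℕ) := Nat.cast_nonneg _
  have hdirect : FigNet.IsDirect h g D :=
    { ε_pos := hε
      ε_le := hε1
      le_tf' := h13
      tf'_le := by linarith
      exitBound_le := by linarith
      induces := hI
      direct := FigNet.ae_eq_zero_of_isEquilibrium hε hε1 (by linarith) (by linarith) hI hp heq }
  -- The walk flow and times witnessing implementability may differ from those witnessing
  -- optimality. Only `g` is shared, so the bound is evaluated at the times `D₀` of the latter.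
  have h1 := hdirect.le_pairing hI₀.traversal
  have h2 := hopt _ _ _ (FigNet.induces_optFlow (by linarith) hε hε1 h13 htf)
  have h3 := FigNet.pairing_optFlow_le (M := M) (by linarith) hε hε1 h13 htf
  linarith
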